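/- **Language.** There are basic individual variables $x_0,x_1,\dots$, countably many predicate symbols of each arity, and justification terms $$t ::= p_i \mid c_i \mid (t\cdot t)\mid (t+t)\mid\, !t \mid\, ?t \mid \mathsf{gen}_x(t)$$ ($p_i$ justification variables, $c_i$ justification constants, $x$ a basic variable). Formulas are $$\varphi ::= P y_1\dots y_n \mid \bot \mid (\varphi\to\varphi)\mid \forall x\varphi\mid t{:}_X\varphi ,$$ $X$ a finite set of individual variables; $\neg\varphi$ is $\varphi\to\bot$, $\varphi\vee\psi$ is $\neg\varphi\to\psi$, $\varphi\wedge\psi$ is $\neg(\varphi\to\neg\psi)$, and $t{:}\varphi$ is $t{:}_\emptyset\varphi$. Free variables are as usual, with $fv(t{:}_X\varphi)=X$: an occurrence in $\varphi$ of a variable outside $X$ is not free in $t{:}_X\varphi$. Substitution acts on free occurrences; $y$ is free for $x$ in $t{:}_X\varphi$ if $x\notin X$, or else $y$ is free for $x$ in $\varphi$ and ($y\in fv(\varphi)$ implies $y\in X$). Let $\mathbf V$ be a countably infinite set of new "witness" variables. *Henkin formulas* are built in the same way from basic and witness variables, but witness variables are never quantified or used as subscripts of $\mathsf{gen}$, and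 occur only free (so in every subformula $t{:}_X\psi$ the witness variables of $\psi$ are in $X$). A Henkin formula is *closed* if no basic variable is free in it. More generally, for a set $D$, *$D$-formulas* are defined in the same way with the members of $D$ in place of the witness variables. **The system FOJT45.** Axiom schemes (classical first-order ones, then the justification ones): $\varphi\to(\psi\to\varphi)$; $(\varphi\to(\psi\to\chi))\to((\varphi\to\psi)\to(\varphi\to\chi))$; $\neg\neg\varphi\to\varphi$; $\forall x\varphi\to\varphi(y/x)$ with $y$ free for $x$ in $\varphi$; $\forall x(\varphi\to\psi)\to(\varphi\to\forall x\psi)$ with $x\notin fv(\varphi)$; $t{:}_{X\cup\{y\}}\varphi\to t{:}_X\varphi$ with $y\notin X\cup fv(\varphi)$; $t{:}_X\varphi\to t{:}_{X\cup\{y\}}\varphi$ with $y\notin X$; $t{:}_X\varphi\to\varphi$; $t{:}_X(\varphi\to\psi)\to(s{:}_X\varphi\to (t\cdot s){:}_X\psi)$; $t{:}_X\varphi\to(t+s){:}_X\varphi$ and $s{:}_X\varphi\to(t+s){:}_X\varphi$; $t{:}_X\varphi\to\, !t{:}_X\,t{:}_X\varphi$; $t{:}_X\varphi\to\mathsf{gen}_x(t){:}_X\forall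 x\varphi$ with $x\notin X$; $\neg\, t{:}_X\varphi\to\, ?t{:}_X\neg\, t{:}_X\varphi$. Rules: modus ponens, and generalization over a basic variable not free in the (finitely many) premises used. A *constant specification* $\mathcal{CS}$ is a set of basic formulas $c{:}\psi$ with $c$ a constant and $\psi$ an axiom of the basic language. It is *axiomatically appropriate* if every axiom $\psi$ of the basic language has some $c{:}\psi\in\mathcal{CS}$. Two formulas are *variable variants* if each comes from the other by a one-to-one renaming of individual variables all of whose occurrences in it are free, no new name being a variable that has a non-free (e.g. quantified) occurrence. $\mathcal{CS}$ is *variant closed* if, whenever $\varphi,\psi$ are variable variants, $c{:}\varphi\in\mathcal{CS}$ iff $c{:}\psi\in\mathcal{CS}$. Its extension $\mathcal{CS}(\mathbf V)$ is the set of all $c{:}_X\psi$ such that $\psi$ is a Henkin formula, $X$ is the set of witness variables of $\psi$, and $\psi$ is a variable variant of some $\varphi$ with $c{:}\varphi\in\mathcal{CS}$. Derivability and consistency below refer to FOJT45 over Henkin formulas with the members of $\mathcal{CS}(\mathbf V)$ as additional axioms; $\Gamma$ is consistent if $\Gamma\nvdash\bot$, and maximally consistent if moreover it is a set of Henkin formulas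 with no proper consistent extension by Henkin formulas. **Templates.** A *disjunctive template* is a propositional modal formula built from propositional letters with $\vee$ and $\Box$ only, no letter occurring twice. If $F(\vec p)$ is one and $\vec\varphi$ are Henkin formulas, the set $\llbracket F(\vec\varphi)\rrbracket$ is defined by: $\llbracket p_i\rrbracket=\{\varphi_i\}$; $\llbracket G\vee H\rrbracket=\{\psi\vee\theta:\psi\in\llbracket G\rrbracket,\theta\in\llbracket H\rrbracket\}$; $\llbracket\Box G\rrbracket=\{t{:}_X\psi:\psi\in\llbracket G\rrbracket,\ t\text{ a term},\ X\text{ the set of witness variables in }\psi\}$; and $\llbracket\neg F(\vec\varphi)\rrbracket=\{\neg\psi:\psi\in\llbracket F(\vec\varphi)\rrbracket\}$. A set $\Gamma$ *admits instantiation* if for all disjunctive templates $F(\vec p,q)$, Henkin formulas $\vec\varphi$ and Henkin formulas $\forall x\varphi(x)$: if $\Gamma\cup\llbracket\neg F(\vec\varphi,\forall x\varphi(x))\rrbracket$ is consistent, then $\Gamma\cup\llbracket\neg F(\vec\varphi,\varphi(a))\rrbracket$ is consistent for some $a\in\mathbf V$. **Models.** A model $\langle W,R,D,I,E\rangle$ has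 worlds $W$, accessibility $R\subseteq W\times W$, a domain $D$, relations $I(P,w)\subseteq D^n$, and evidence $E(t,\varphi)\subseteq W$ for $D$-formulas $\varphi$. Truth of closed $D$-formulas at $w$ is defined by: $w\Vdash P(\vec a)$ iff $\vec a\in I(P,w)$; $w\not\Vdash\bot$; $w\Vdash\psi\to\theta$ iff $w\not\Vdash\psi$ or $w\Vdash\theta$; $w\Vdash\forall x\psi(x)$ iff $w\Vdash\psi(a)$ for all $a\in D$; $w\Vdash t{:}_X\psi$ iff $w\in E(t,\psi)$ and, for all $w'$ with $wRw'$, $w'\Vdash\psi(\vec a)$ for every replacement of all the free variables of $\psi$ by members $\vec a$ of $D$. The model is *fully explanatory* if for every closed $D$-formula $\varphi$ and every $w\in W$: if $v\Vdash\varphi$ for all $v$ with $wRv$, then there is a justification term $t$ with $w\Vdash t{:}_X\varphi$, where $X$ is the set of members of $D$ occurring in $\varphi$. The *canonical model* of FOJT45 using $\mathcal{CS}$ is: $W$ is the set of maximally consistent sets that admit instantiation; $\Gamma R\Delta$ iff $\Gamma^\#\subseteq\Delta$, where $\Gamma^\#$ is the set of all $\forall\vec y\,\varphi$ such that $t{:}_X\varphi\in\Gamma$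 for some $t$ and closed Henkin formula $t{:}_X\varphi$, with $X$ the set of witness variables in $\varphi$ and $\vec y$ the free basic variables of $\varphi$; $D=\mathbf V$; $I(P,\Gamma)=\{\vec a: P(\vec a)\in\Gamma\}$; $\Gamma\in E(t,\varphi)$ iff $t{:}_X\varphi$ is a closed Henkin formula in $\Gamma$, where $X$ is the set of witness variables in $\varphi$. **Theorem.** Let $\mathcal{CS}$ be a variant closed and axiomatically appropriate constant specification. Then the canonical model of FOJT45 using $\mathcal{CS}$ is fully explanatory. -/

import Mathlib

namespace FOJT45

universe u v

/-! ### Syntax -/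

/-- Justification terms of FOJT45: variables `p i`, constants `c i`, `t ⬝ s`, `t + s`, `! t`,
`? t`, and `gen x t` for each basic individual variable `x`. -/
inductive Term : Type
  | var (i : ℕ) : Term
  | const (i : ℕ) : Term
  | app (t s : Term) : Term
  | sum (t s : Term) : Term
  | bang (t : Term) : Term
  | quest (t : Term) : Term
  | gen (x : ℕ) (t : Term) : Term

/-- Individual variables and domain constants: `Sum.inl x` is the basic variable `x`, and
`Sum.inr d` is the element `d` of `D`. When `D` is the set of witness variables, `Var D` is the
set of all individual variables, basic or witness. -/
abbrev Var (D : Type u) : Type u := ℕ ⊕ D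

/-- Formulas in which members of `D` may stand for individuals. `rel n k args` is the `k`-th
`n`-ary predicate symbol applied to `args`, and `jst t X φ` is `t :_X φ`. Only basic variables are
quantified. Formulas of the basic language are the elements of `Fml Empty`. -/
inductive Fml (D : Type u) : Type u
  | rel (n k : ℕ) (args : Fin n → Var D) : Fml D
  | bot : Fml D
  | imp (φ ψ : Fml D) : Fml D
  | all (x : ℕ) (φ : Fml D) : Fml D
  | jst (t : Term) (X : Finset (Var D)) (φ : Fml D) : Fml D

namespace Fml

variable {D : Type u}

def neg (φ : Fml D) : Fml D := imp φ bot

def or (φ ψ : Fml D) : Fml D := imp (neg φ) ψ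

def and (φ ψ : Fml D) : Fml D := neg (imp φ (neg ψ))

/-- `∀ y₁ … ∀ yₙ φ`. -/
def alls (ys : List ℕ) (φ : Fml D) : Fml D := ys.foldr all φ

/-- The number of logical symbols of a formula. -/
def degree : Fml D → ℕ
  | rel _ _ _ => 0
  | bot => 0
  | imp φ ψ => φ.degree + ψ.degree + 1
  | all _ φ => φ.degree + 1
  | jst _ _ φ => φ.degree + 1

variable [DecidableEq D]

/-- Free variables; the free variables of `t :_X φ` are the members of `X`. -/
def fv : Fml D → Finset (Var D)
  | rel _ _ args => Finset.univ.image args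
  | bot => ∅
  | imp φ ψ => φ.fv ∪ ψ.fv
  | all x φ => φ.fv.erase (Sum.inl x)
  | jst _ X _ => X

/-- The variables that have an occurrence in the formula which is not free: quantified ones, and
those that occur free in some `φ` inside `t :_X φ` without belonging to `X`. -/
def nonfree : Fml D → Finset (Var D)
  | rel _ _ _ => ∅
  | bot => ∅
  | imp φ ψ => φ.nonfree ∪ ψ.nonfree
  | all x φ => insert (Sum.inl x) φ.nonfree
  | jst _ X φ => φ.nonfree ∪ (φ.fv \ X)

/-- The members of `D` (witness variables, domain constants) that occur in the formula. -/
def wit : Fml D → Finset D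
  | rel _ _ args => (Finset.univ.image args).toRight
  | bot => ∅
  | imp φ ψ => φ.wit ∪ ψ.wit
  | all _ φ => φ.wit
  | jst _ X φ => X.toRight ∪ φ.wit

/-- The set of members of `D` occurring in the formula, as a subscript set. -/
def witSet (φ : Fml D) : Finset (Var D) := φ.wit.map Function.Embedding.inr

/-- `D`-formulas (Henkin formulas, when `D` is the set of witness variables): members of `D`
occur only free, i.e. each `t :_X φ` in the formula has all the members of `D` that occur in `φ`
in its subscript `X`. -/
def IsHenkin : Fml D → Prop
  | rel _ _ _ => True
  | bot => True
  | imp φ ψ => φ.IsHenkin ∧ ψ.IsHenkin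
  | all _ φ => φ.IsHenkin
  | jst _ X φ => φ.wit ⊆ X.toRight ∧ φ.IsHenkin

/-- No basic variable is free. -/
def IsClosed (φ : Fml D) : Prop := ∀ x : ℕ, Sum.inl x ∉ φ.fv

/-- Simultaneous replacement of the free occurrences of all `v` by `σ v`. -/
def subst : (Var D → Var D) → Fml D → Fml D
  | σ, rel n k args => rel n k (fun i => σ (args i))
  | _, bot => bot
  | σ, imp φ ψ => imp (φ.subst σ) (ψ.subst σ)
  | σ, all x φ => all x (φ.subst (Function.update σ (Sum.inl x) (Sum.inl x)))
  | σ, jst t X φ => jst t (X.image σ) (φ.subst (fun v => if v ∈ X then σ v else v))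

/-- `φ(y/x)`. -/
def subst1 (x : ℕ) (y : Var D) (φ : Fml D) : Fml D :=
  φ.subst (Function.update id (Sum.inl x) y)

/-- `y` is free for `x` in the formula. In the last two cases there is nothing to check when `x`
is not free in the formula. -/
def FreeFor (y : Var D) (x : ℕ) : Fml D → Prop
  | rel _ _ _ => True
  | bot => True
  | imp φ ψ => φ.FreeFor y x ∧ ψ.FreeFor y x
  | all z φ => Sum.inl x ∉ (all z φ).fv ∨ (y ≠ Sum.inl z ∧ φ.FreeFor y x)
  | jst _ X φ => Sum.inl x ∉ X ∨ (φ.FreeFor y x ∧ (y ∈ φ.fv → y ∈ X))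

/-- The inclusion of the basic language in the language with members of `D`. -/
def emb : Fml Empty → Fml D
  | rel n k args => rel n k (fun i => Sum.map id Empty.elim (args i))
  | bot => bot
  | imp φ ψ => imp φ.emb ψ.emb
  | all x φ => all x φ.emb
  | jst t X φ => jst t (X.image (Sum.map id Empty.elim)) φ.emb

theorem degree_subst (σ : Var D → Var D) (φ : Fml D) : (φ.subst σ).degree = φ.degree := by
  induction φ generalizing σ with
  | rel n k args => rfl
  | bot => rfl
  | imp φ ψ ih1 ih2 => simp [subst, degree, ih1, ih2]
  | all x φ ih => simp [subst, degree, ih]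
  | jst t X φ ih => simp [subst, degree, ih]

end Fml

open Fml

/-! ### The system FOJT45 -/

section System

variable {D : Type u} [DecidableEq D]

/-- The schemes of FOJT45: classical first-order logic (A1), then A2, A3 and B1 to B6. -/
inductive IsAx : Fml D → Prop
  | k (φ ψ : Fml D) : IsAx (imp φ (imp ψ φ))
  | s (φ ψ χ : Fml D) :
      IsAx (imp (imp φ (imp ψ χ)) (imp (imp φ ψ) (imp φ χ)))
  | dne (φ : Fml D) : IsAx (imp (neg (neg φ)) φ)
  | inst (x : ℕ) (y : Var D) (φ : Fml D) (h : φ.FreeFor y x) :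
      IsAx (imp (all x φ) (φ.subst1 x y))
  | allImp (x : ℕ) (φ ψ : Fml D) (h : Sum.inl x ∉ φ.fv) :
      IsAx (imp (all x (imp φ ψ)) (imp φ (all x ψ)))
  | a2 (t : Term) (X : Finset (Var D)) (y : Var D) (φ : Fml D) (hX : y ∉ X) (h : y ∉ φ.fv) :
      IsAx (imp (jst t (insert y X) φ) (jst t X φ))
  | a3 (t : Term) (X : Finset (Var D)) (y : Var D) (φ : Fml D) (hX : y ∉ X) :
      IsAx (imp (jst t X φ) (jst t (insert y X) φ))
  | b1 (t : Term) (X : Finset (Var D)) (φ : Fml D) : IsAx (imp (jst t X φ) φ)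
  | b2 (t s : Term) (X : Finset (Var D)) (φ ψ : Fml D) :
      IsAx (imp (jst t X (imp φ ψ)) (imp (jst s X φ) (jst (Term.app t s) X ψ)))
  | b3l (t s : Term) (X : Finset (Var D)) (φ : Fml D) :
      IsAx (imp (jst t X φ) (jst (Term.sum t s) X φ))
  | b3r (t s : Term) (X : Finset (Var D)) (φ : Fml D) :
      IsAx (imp (jst s X φ) (jst (Term.sum t s) X φ))
  | b4 (t : Term) (X : Finset (Var D)) (φ : Fml D) :
      IsAx (imp (jst t X φ) (jst (Term.bang t) X (jst t X φ)))
  | b5 (t : Term) (X : Finset (Var D)) (x : ℕ) (φ : Fml D) (h : Sum.inl x ∉ X) :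
      IsAx (imp (jst t X φ) (jst (Term.gen x t) X (all x φ)))
  | b6 (t : Term) (X : Finset (Var D)) (φ : Fml D) :
      IsAx (imp (neg (jst t X φ)) (jst (Term.quest t) X (neg (jst t X φ))))

/-- Derivations from the set `Γ` of premises in the system whose additional postulates are the
members of `C`; generalization is not applied to a variable that is free in a premise. -/
inductive Deriv (C Γ : Set (Fml D)) : Fml D → Prop
  | ax {φ : Fml D} (hφ : φ.IsHenkin) (h : IsAx φ) : Deriv C Γ φ
  | spec {φ : Fml D} (h : φ ∈ C) : Deriv C Γ φ
  | hyp {φ : Fml D} (h : φ ∈ Γ) : Deriv C Γ φ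
  | mp {φ ψ : Fml D} (h₁ : Deriv C Γ φ) (h₂ : Deriv C Γ (imp φ ψ)) : Deriv C Γ ψ
  | gen {φ : Fml D} (x : ℕ) (hx : ∀ ψ ∈ Γ, Sum.inl x ∉ ψ.fv) (h : Deriv C Γ φ) :
      Deriv C Γ (all x φ)

/-- `Γ ⊢ φ`. A derivation uses finitely many premises, and the restriction on generalization
concerns these. -/
def Proves (C Γ : Set (Fml D)) (φ : Fml D) : Prop :=
  ∃ Γ₀ : Set (Fml D), Γ₀ ⊆ Γ ∧ Γ₀.Finite ∧ Deriv C Γ₀ φ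

def Consistent (C Γ : Set (Fml D)) : Prop := ¬ Proves C Γ bot

/-- Maximal among the consistent sets of Henkin formulas. -/
structure MaxConsistent (C Γ : Set (Fml D)) : Prop where
  henkin : ∀ φ ∈ Γ, φ.IsHenkin
  consistent : Consistent C Γ
  maximal : ∀ Δ : Set (Fml D), (∀ φ ∈ Δ, φ.IsHenkin) → Consistent C Δ → Γ ⊆ Δ → Δ = Γ

/-- `ψ` comes from `φ` by a one-to-one renaming of variables all of whose occurrences are free;
all the other variables of `φ` are left alone and are not used as new names. -/
def VariableVariant (φ ψ : Fml D) : Prop :=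
  ∃ σ : Equiv.Perm (Var D), (∀ v ∈ φ.nonfree, σ v = v) ∧ φ.subst σ = ψ

end System

/-! ### Constant specifications -/

/-- `c : ψ`, i.e. `c :_∅ ψ`, for the justification constant `c`. -/
def cst {D : Type u} (c : ℕ) (ψ : Fml D) : Fml D := jst (Term.const c) ∅ ψ

def IsConstantSpecification (CS : Set (Fml Empty)) : Prop :=
  ∀ χ ∈ CS, ∃ (c : ℕ) (ψ : Fml Empty), IsAx ψ ∧ χ = cst c ψ

def AxiomaticallyAppropriate (CS : Set (Fml Empty)) : Prop :=
  ∀ ψ : Fml Empty, IsAx ψ → ∃ c : ℕ, cst c ψ ∈ CS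

def VariantClosed (CS : Set (Fml Empty)) : Prop :=
  ∀ (c : ℕ) (φ ψ : Fml Empty), VariableVariant φ ψ → (cst c φ ∈ CS ↔ cst c ψ ∈ CS)

/-- The extension `CS(V)` of a constant specification to Henkin formulas. The subscript of a
member is the set of witness variables of the justified formula, as it has to be for the member
to be a Henkin formula itself. -/
def extend {V : Type u} [DecidableEq V] (CS : Set (Fml Empty)) : Set (Fml V) :=
  {χ | ∃ (c : ℕ) (φ : Fml Empty) (ψ : Fml V), cst c φ ∈ CS ∧ ψ.IsHenkin ∧
    VariableVariant φ.emb ψ ∧ χ = jst (Term.const c) ψ.witSet ψ}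

/-! ### Templates -/

/-- Propositional modal formulas over the letters `0, 1, 2, …`. -/
inductive Template : Type
  | letter (i : ℕ) : Template
  | neg (F : Template) : Template
  | or (F G : Template) : Template
  | and (F G : Template) : Template
  | box (F : Template) : Template

namespace Template

/-- The list of occurrences of letters. -/
def letters : Template → List ℕ
  | letter i => [i]
  | neg F => F.letters
  | or F G => F.letters ++ G.letters
  | and F G => F.letters ++ G.letters
  | box F => F.letters

/-- No boolean connective other than `∨` occurs. -/
def OnlyOr : Template → Prop
  | letter _ => True
  | neg _ => False
  | or F G => F.OnlyOr ∧ G.OnlyOr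
  | and _ _ => False
  | box F => F.OnlyOr

/-- Disjunctive templates; in a template no letter occurs more than once. -/
def IsDisjunctive (F : Template) : Prop := F.letters.Nodup ∧ F.OnlyOr

/-- The instantiation set of a template when letter `i` is instantiated by the formula `e i`. -/
def inst {V : Type u} [DecidableEq V] (e : ℕ → Fml V) : Template → Set (Fml V)
  | letter i => {e i}
  | neg F => {χ | ∃ ψ ∈ F.inst e, χ = ψ.neg}
  | or F G => {χ | ∃ ψ ∈ F.inst e, ∃ θ ∈ G.inst e, χ = ψ.or θ}
  | and F G => {χ | ∃ ψ ∈ F.inst e, ∃ θ ∈ G.inst e, χ = ψ.and θ}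
  | box F => {χ | ∃ ψ ∈ F.inst e, ∃ t : Term, χ = jst t ψ.witSet ψ}

end Template

section Canonical

variable {V : Type u} [DecidableEq V]

/-- For each disjunctive template `F(p⃗, q)`, Henkin formulas `φ⃗` and universal Henkin formula
`∀ x φ(x)`: if `Γ ∪ ⟦¬ F(φ⃗, ∀ x φ(x))⟧` is consistent, then so is `Γ ∪ ⟦¬ F(φ⃗, φ(a))⟧` for some
witness variable `a`. -/
def AdmitsInstantiation (C Γ : Set (Fml V)) : Prop :=
  ∀ (F : Template) (q : ℕ) (e : ℕ → Fml V) (x : ℕ) (φ : Fml V),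
    F.IsDisjunctive → (∀ i, (e i).IsHenkin) → φ.IsHenkin →
    Consistent C (Γ ∪ (Template.neg F).inst (Function.update e q (all x φ))) →
    ∃ a : V, Consistent C
      (Γ ∪ (Template.neg F).inst (Function.update e q (φ.subst1 x (Sum.inr a))))

/-- `Γ^#`: the formulas `∀ y⃗ φ` such that `t :_X φ ∈ Γ` is a closed Henkin formula, `X` is the set
of witness variables in `φ`, and `y⃗` lists the free basic variables of `φ`. -/
def sharp (Γ : Set (Fml V)) : Set (Fml V) :=
  {χ | ∃ (t : Term) (φ : Fml V) (ys : List ℕ),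
    jst t φ.witSet φ ∈ Γ ∧ (jst t φ.witSet φ).IsHenkin ∧ (jst t φ.witSet φ).IsClosed ∧
    ys.Nodup ∧ (∀ y, y ∈ ys ↔ Sum.inl y ∈ φ.fv) ∧ χ = alls ys φ}

end Canonical

/-! ### Constant domain models -/

/-- The data of a Fitting model with domain `D`: worlds, accessibility, an interpretation of the
predicate symbols at each world, and an evidence function. -/
structure Model (D : Type u) where
  W : Type v
  R : W → W → Prop
  I : (n k : ℕ) → W → Set (Fin n → D)
  E : Term → Fml D → Set W

namespace Model

variable {D : Type u} [DecidableEq D]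

/-- Truth of closed `D`-formulas at a world. In the clause for `t :_X ψ`, all the free variables
of `ψ` are replaced by members of the domain, in all possible ways. -/
def Truth (M : Model.{u, v} D) (w : M.W) : Fml D → Prop
  | rel n k args => ∃ a : Fin n → D, (∀ i, args i = Sum.inr (a i)) ∧ a ∈ M.I n k w
  | bot => False
  | imp ψ θ => ¬ M.Truth w ψ ∨ M.Truth w θ
  | all x ψ => ∀ a : D, M.Truth w (ψ.subst1 x (Sum.inr a))
  | jst t _ ψ => w ∈ M.E t ψ ∧ ∀ w' : M.W, M.R w w' →
      ∀ a : ℕ → D, M.Truth w' (ψ.subst (Sum.elim (fun x => Sum.inr (a x)) Sum.inr))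
termination_by φ => φ.degree
decreasing_by all_goals simp [degree, subst1, degree_subst]

/-- For each closed `D`-formula `φ` and each world `w`, if `φ` is true at all the worlds accessible
from `w`, then `t :_X φ` is true at `w` for some justification term `t`, where `X` is the set of
domain constants in `φ`. -/
def FullyExplanatory (M : Model.{u, v} D) : Prop :=
  ∀ φ : Fml D, φ.IsHenkin → φ.IsClosed → ∀ w : M.W,
    (∀ w' : M.W, M.R w w' → M.Truth w' φ) → ∃ t : Term, M.Truth w (jst t φ.witSet φ)

end Model

/-- The canonical model of FOJT45 using `CS`, with the set `V` of witness variables as domain. -/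
def canonicalModel (V : Type u) [DecidableEq V] (CS : Set (Fml Empty)) : Model.{u, u} V where
  W := {Γ : Set (Fml V) //
    MaxConsistent (extend CS) Γ ∧ AdmitsInstantiation (extend CS) Γ}
  R Γ Δ := sharp Γ.1 ⊆ Δ.1
  I n k Γ := {a | rel n k (fun i => Sum.inr (a i)) ∈ Γ.1}
  E t φ := {Γ | (jst t φ.witSet φ).IsHenkin ∧ (jst t φ.witSet φ).IsClosed ∧
    jst t φ.witSet φ ∈ Γ.1}

end FOJT45

/-! The argument is by contraposition. Suppose that no `t :_X φ`, with `X` the witnesses of `φ`,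
lies in a world `Γ`. Then `Γ^# ∪ {¬φ}` is consistent: a derivation of `φ` from `Γ^#` could be
internalized into a justification of `φ` derivable from `Γ` (`justified_of_der_sharp`). If this set
extends to a world `Δ`, then `Δ` is accessible from `Γ` and omits `φ`, and the truth lemma
`truth_iff_mem` refutes `φ` at `Δ`.

The difficulty is that the domain is fixed, so no fresh witnesses are available when `Δ` is built.
Templates replace them. Instantiation for `F` over `Γ^#` comes from instantiation for `□F` over `Γ`
(`instantiable_sharp`), and instantiation for `G` over `Γ ∪ ⟦¬F⟧` comes from `F ∨ G` over `Γ`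
(`Instantiable.union_inst`). Hence the property survives every stage of a Lindenbaum construction,
and the deductive closure of the limit is a world (`exists_world`). Although `⟦F⟧` is infinite, it
is directed under provable implication (`Template.exists_join`), so inconsistency with `⟦¬F⟧` means
derivability of a single member of `⟦F⟧`.

Internalization (`Justified.of_der`) needs a justification for every Henkin axiom. There is one
because such an axiom is a variable variant of a basic axiom (`IsAx.exists_variant`). It also
eliminates generalization: if `t` justifies a theorem `φ`, then `gen x t` justifies `∀ x φ`, and
factivity (`b1`) returns `∀ x φ`. Consistency can therefore be studied through `Der`, whose only
rule is modus ponens. -/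

namespace FOJT45

universe u v

open Fml

namespace Fml

/-! ### Renaming of variables, and reduction of Henkin axioms to basic ones. -/

section Formulas

variable {D : Type u} [DecidableEq D] {D' : Type v} [DecidableEq D']

/-- Application of `f` to all occurrences of variables other than quantifiers. -/
def map (f : Var D → Var D') : Fml D → Fml D'
  | rel n k args => rel n k (fun i => f (args i))
  | bot => bot
  | imp φ ψ => imp (φ.map f) (ψ.map f)
  | all x φ => all x (φ.map f)
  | jst t X φ => jst t (X.image f) (φ.map f)

/-- All the variables that occur in a formula. -/
def vars : Fml D → Finset (Var D)
  | rel _ _ args => Finset.univ.image args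
  | bot => ∅
  | imp φ ψ => φ.vars ∪ ψ.vars
  | all x φ => insert (Sum.inl x) φ.vars
  | jst _ X φ => X ∪ φ.vars

theorem fv_subset_vars (φ : Fml D) : φ.fv ⊆ φ.vars := by
  induction φ with
  | rel n k args => exact subset_rfl
  | bot => exact subset_rfl
  | imp φ ψ ih1 ih2 => exact Finset.union_subset_union ih1 ih2
  | all x φ ih =>
    exact ((Finset.erase_subset _ _).trans ih).trans (Finset.subset_insert _ _)
  | jst t X φ ih => exact Finset.subset_union_left

theorem nonfree_subset_vars (φ : Fml D) : φ.nonfree ⊆ φ.vars := by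
  induction φ with
  | rel n k args => exact Finset.empty_subset _
  | bot => exact subset_rfl
  | imp φ ψ ih1 ih2 => exact Finset.union_subset_union ih1 ih2
  | all x φ ih => exact Finset.insert_subset_insert _ ih
  | jst t X φ ih =>
    exact (Finset.union_subset ih (Finset.sdiff_subset.trans (fv_subset_vars φ))).trans
      Finset.subset_union_right

theorem inr_mem_wit_of_mem_fv {φ : Fml D} {d : D} (h : Sum.inr d ∈ φ.fv) : d ∈ φ.wit := by
  induction φ with
  | rel n k args => simpa [fv, wit] using h
  | bot => simp [fv] at h
  | imp φ ψ ih1 ih2 =>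
    simp only [fv, wit, Finset.mem_union] at h ⊢
    exact h.imp ih1 ih2
  | all x φ ih => exact ih (Finset.mem_of_mem_erase h)
  | jst t X φ ih => exact Finset.mem_union_left _ (by simpa [fv] using h)

theorem map_map_eq_self {f : Var D → Var D'} {g : Var D' → Var D} (φ : Fml D)
    (h : ∀ v ∈ φ.vars, g (f v) = v) : (φ.map f).map g = φ := by
  induction φ with
  | rel n k args =>
    simp only [map, rel.injEq, heq_eq_eq, true_and]
    funext i
    exact h _ (by simp [vars])
  | bot => rfl
  | imp φ ψ ih1 ih2 =>
    simp only [vars, Finset.mem_union] at h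
    simp only [map]
    rw [ih1 fun v hv => h v (.inl hv), ih2 fun v hv => h v (.inr hv)]
  | all x φ ih =>
    simp only [map]
    rw [ih fun v hv => h v (by simp [vars, hv])]
  | jst t X φ ih =>
    simp only [vars, Finset.mem_union] at h
    simp only [map]
    rw [ih fun v hv => h v (.inr hv), Finset.image_image,
      Finset.image_congr (show Set.EqOn (g ∘ f) id X from fun v hv => h v (.inl hv)),
      Finset.image_id]

omit [DecidableEq D] in
theorem emb_map {φ : Fml D} {f : Var D → Var Empty} :
    (φ.map f).emb = (φ.map (Sum.map id Empty.elim ∘ f) : Fml D') := by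
  induction φ with
  | rel n k args => rfl
  | bot => rfl
  | imp φ ψ ih1 ih2 => simp [map, emb, ih1, ih2]
  | all x φ ih => simp [map, emb, ih]
  | jst t X φ ih => simp [map, emb, ih, Finset.image_image]

theorem subst_congr {σ τ : Var D → Var D} {φ : Fml D} (h : ∀ v ∈ φ.fv, σ v = τ v) :
    φ.subst σ = φ.subst τ := by
  induction φ generalizing σ τ with
  | rel n k args =>
    simp only [subst, rel.injEq, heq_eq_eq, true_and]
    funext i
    exact h _ (by simp [fv])
  | bot => rfl
  | imp φ ψ ih1 ih2 =>
    simp only [fv, Finset.mem_union] at h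
    simp only [subst]
    rw [ih1 fun v hv => h v (.inl hv), ih2 fun v hv => h v (.inr hv)]
  | all x φ ih =>
    simp only [subst]
    rw [ih fun v hv => ?_]
    by_cases hx : v = Sum.inl x
    · simp [hx]
    · rw [Function.update_of_ne hx, Function.update_of_ne hx]
      exact h v (Finset.mem_erase.2 ⟨hx, hv⟩)
  | jst t X φ ih =>
    simp only [subst]
    rw [ih fun v hv => ?_, Finset.image_congr (show Set.EqOn σ τ X from h)]
    split_ifs with hX
    · exact h v hX
    · rfl

theorem subst_id (φ : Fml D) : φ.subst id = φ := by
  induction φ with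
  | rel n k args => rfl
  | bot => rfl
  | imp φ ψ ih1 ih2 => simp [subst, ih1, ih2]
  | all x φ ih =>
    have : Function.update id (Sum.inl x : Var D) (Sum.inl x) = id := Function.update_eq_self _ _
    simp only [subst]
    rw [this, ih]
  | jst t X φ ih =>
    have : (fun v : Var D => if v ∈ X then id v else v) = id := by
      funext v; simp
    simp only [subst]
    rw [this, ih, Finset.image_id]

/-- The guards in `subst` protect exactly the nonfree occurrences; when `σ` fixes those variables
anyway, the guards do nothing. Variable variants can thus be computed with the unguarded `map`. -/
theorem subst_eq_map_of_nonfree {σ : Var D → Var D} {φ : Fml D} (h : ∀ v ∈ φ.nonfree, σ v = v) :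
    φ.subst σ = φ.map σ := by
  induction φ with
  | rel n k args => rfl
  | bot => rfl
  | imp φ ψ ih1 ih2 =>
    simp only [nonfree, Finset.mem_union] at h
    simp only [subst, map]
    rw [ih1 fun v hv => h v (.inl hv), ih2 fun v hv => h v (.inr hv)]
  | all x φ ih =>
    simp only [nonfree, Finset.mem_insert] at h
    simp only [subst, map]
    rw [Function.update_eq_self_iff.2 (h _ (.inl rfl)).symm, ih fun v hv => h v (.inr hv)]
  | jst t X φ ih =>
    simp only [nonfree, Finset.mem_union, Finset.mem_sdiff] at h
    simp only [subst, map]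
    rw [← ih fun v hv => h v (.inl hv)]
    congr 1
    refine subst_congr fun v hv => ?_
    split_ifs with hX
    · rfl
    · exact (h v (.inr ⟨hv, hX⟩)).symm

section Map

variable {f : Var D → Var D'}

omit [DecidableEq D] in
theorem mem_image_iff_of_injOn {S X : Finset (Var D)} (hf : Set.InjOn f S) (hX : X ⊆ S)
    {v : Var D} (hv : v ∈ S) : f v ∈ X.image f ↔ v ∈ X := by
  refine ⟨fun h => ?_, Finset.mem_image_of_mem f⟩
  obtain ⟨u, hu, huv⟩ := Finset.mem_image.1 h
  exact hf (hX hu) hv huv ▸ hu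

theorem fv_map (hinl : ∀ x, f (Sum.inl x) = Sum.inl x) {S : Finset (Var D)}
    (hf : Set.InjOn f S) {φ : Fml D} (hS : φ.vars ⊆ S) :
    (φ.map f).fv = φ.fv.image f := by
  induction φ with
  | rel n k args => simp only [map, fv, Finset.image_image]; rfl
  | bot => rfl
  | imp φ ψ ih1 ih2 =>
    simp only [vars, Finset.union_subset_iff] at hS
    simp only [map, fv, Finset.image_union, ih1 hS.1, ih2 hS.2]
  | all x φ ih =>
    simp only [vars, Finset.insert_subset_iff] at hS
    simp only [map, fv, ih hS.2]
    ext v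
    simp only [Finset.mem_erase, Finset.mem_image]
    constructor
    · rintro ⟨hv, u, hu, rfl⟩
      exact ⟨u, ⟨fun h => hv (h ▸ hinl x), hu⟩, rfl⟩
    · rintro ⟨u, ⟨hux, hu⟩, rfl⟩
      refine ⟨fun h => hux ?_, u, hu, rfl⟩
      exact hf (hS.2 (fv_subset_vars _ hu)) hS.1 (h.trans (hinl x).symm)
  | jst t X φ ih => rfl

theorem nonfree_map (hinl : ∀ x, f (Sum.inl x) = Sum.inl x) {S : Finset (Var D)}
    (hf : Set.InjOn f S) {φ : Fml D} (hS : φ.vars ⊆ S) :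
    (φ.map f).nonfree = φ.nonfree.image f := by
  induction φ with
  | rel n k args => rfl
  | bot => rfl
  | imp φ ψ ih1 ih2 =>
    simp only [vars, Finset.union_subset_iff] at hS
    simp only [map, nonfree, Finset.image_union, ih1 hS.1, ih2 hS.2]
  | all x φ ih =>
    simp only [vars, Finset.insert_subset_iff] at hS
    simp only [map, nonfree, ih hS.2, Finset.image_insert, hinl]
  | jst t X φ ih =>
    simp only [vars, Finset.union_subset_iff] at hS
    simp only [map, nonfree, ih hS.2, Finset.image_union, fv_map hinl hf hS.2]
    congr 1
    ext v
    simp only [Finset.mem_sdiff, Finset.mem_image (s := φ.fv),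
      Finset.mem_image (s := φ.fv \ X)]
    constructor
    · rintro ⟨⟨u, hu, rfl⟩, h⟩
      exact ⟨u, ⟨hu, fun hX => h (Finset.mem_image_of_mem f hX)⟩, rfl⟩
    · rintro ⟨u, ⟨hu, hX⟩, rfl⟩
      exact ⟨⟨u, hu, rfl⟩, fun h =>
        hX ((mem_image_iff_of_injOn hf hS.1 (hS.2 (fv_subset_vars _ hu))).1 h)⟩

/-- Injectivity on `S` keeps `f` from identifying a variable with a quantified one, or an outsider
with a member of a subscript, so the guards of the two substitutions agree. -/
theorem map_subst (hinl : ∀ x, f (Sum.inl x) = Sum.inl x) {S : Finset (Var D)}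
    (hf : Set.InjOn f S) {φ : Fml D} (hS : φ.vars ⊆ S)
    {σ : Var D → Var D} {τ : Var D' → Var D'} (h : ∀ v ∈ S, f (σ v) = τ (f v)) :
    (φ.subst σ).map f = (φ.map f).subst τ := by
  induction φ generalizing σ τ with
  | rel n k args =>
    simp only [map, subst, rel.injEq, heq_eq_eq, true_and]
    funext i
    exact h _ (hS (by simp [vars]))
  | bot => rfl
  | imp φ ψ ih1 ih2 =>
    simp only [vars, Finset.union_subset_iff] at hS
    simp only [map, subst, ih1 hS.1 h, ih2 hS.2 h]
  | all x φ ih =>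
    simp only [vars, Finset.insert_subset_iff] at hS
    simp only [map, subst]
    rw [ih hS.2 fun v hv => ?_]
    by_cases hx : v = Sum.inl x
    · simp [hx, hinl]
    · rw [Function.update_of_ne hx, Function.update_of_ne, h v hv]
      exact fun h' => hx (hf hv hS.1 (h'.trans (hinl x).symm))
  | jst t X φ ih =>
    simp only [vars, Finset.union_subset_iff] at hS
    simp only [map, subst, Finset.image_image]
    rw [ih hS.2 fun v hv => ?_, 
      Finset.image_congr (show Set.EqOn (f ∘ σ) (τ ∘ f) X from fun v hv => h v (hS.1 hv))]
    simp only [mem_image_iff_of_injOn hf hS.1 hv]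
    split_ifs
    · exact h v hv
    · rfl

theorem map_subst1 (hinl : ∀ x, f (Sum.inl x) = Sum.inl x) {S : Finset (Var D)}
    (hf : Set.InjOn f S) {φ : Fml D} (hS : φ.vars ⊆ S)
    {x : ℕ} (hx : Sum.inl x ∈ S) (y : Var D) :
    (φ.subst1 x y).map f = (φ.map f).subst1 x (f y) := by
  refine map_subst hinl hf hS fun v hv => ?_
  by_cases h : v = Sum.inl x
  · simp [h, hinl]
  · rw [Function.update_of_ne h, Function.update_of_ne]
    · rfl
    · exact fun h' => h (hf hv hx (h'.trans (hinl x).symm))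

theorem FreeFor.map (hinl : ∀ x, f (Sum.inl x) = Sum.inl x) {S : Finset (Var D)}
    (hf : Set.InjOn f S) {φ : Fml D} (hS : φ.vars ⊆ S)
    {x : ℕ} (hx : Sum.inl x ∈ S) {y : Var D} (hy : y ∈ S) (h : φ.FreeFor y x) :
    (φ.map f).FreeFor (f y) x := by
  induction φ with
  | rel n k args => trivial
  | bot => trivial
  | imp φ ψ ih1 ih2 =>
    simp only [vars, Finset.union_subset_iff] at hS
    exact ⟨ih1 hS.1 h.1, ih2 hS.2 h.2⟩
  | all z φ ih =>
    rcases h with h | h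
    · left
      change _ ∉ (Fml.map f (Fml.all z φ)).fv
      rw [fv_map hinl hf hS, ← hinl x,
        mem_image_iff_of_injOn hf ((fv_subset_vars _).trans hS) hx]
      exact h
    · simp only [vars, Finset.insert_subset_iff] at hS
      refine .inr ⟨fun h' => h.1 (hf hy hS.1 (h'.trans (hinl z).symm)), ih hS.2 h.2⟩
  | jst t X φ ih =>
    simp only [vars, Finset.union_subset_iff] at hS
    simp only [Fml.map, FreeFor]
    rw [fv_map hinl hf hS.2,
      mem_image_iff_of_injOn hf ((fv_subset_vars _).trans hS.2) hy, ← hinl x,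
      mem_image_iff_of_injOn hf hS.1 hx, mem_image_iff_of_injOn hf hS.1 hy]
    exact h.imp_right fun h => ⟨ih hS.2 h.1, h.2⟩

end Map

/-- Side conditions of the schemes are inequalities and non-memberships of variables, which survive
a renaming that identifies none of those involved. Injectivity is asked only on a finite set: a map
into `Var Empty` that fixes the basic variables cannot be injective if there are witnesses. -/
theorem _root_.FOJT45.IsAx.map {ψ : Fml D} (h : IsAx ψ) : ∃ S : Finset (Var D), ψ.vars ⊆ S ∧
    ∀ f : Var D → Var D', (∀ x, f (Sum.inl x) = Sum.inl x) → Set.InjOn f S →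
      IsAx (ψ.map f) := by
  cases h with
  | k φ ψ => exact ⟨_, subset_rfl, fun _ _ _ => .k _ _⟩
  | s φ ψ χ => exact ⟨_, subset_rfl, fun _ _ _ => .s _ _ _⟩
  | dne φ => exact ⟨_, subset_rfl, fun _ _ _ => .dne _⟩
  | inst x y φ h =>
    -- `y` is added by hand, since it need not occur in the axiom when `x` is not free in `φ`.
    refine ⟨insert y (vars _), Finset.subset_insert _ _, fun f hinl hf => ?_⟩
    have hS : φ.vars ⊆ insert y (((φ.all x).imp (φ.subst1 x y)).vars) := by
      intro v hv; simp [vars, hv]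
    have hx : Sum.inl x ∈ insert y (((φ.all x).imp (φ.subst1 x y)).vars) := by simp [vars]
    have := IsAx.inst x (f y) _ (h.map hinl hf hS hx (Finset.mem_insert_self _ _))
    rwa [← map_subst1 hinl hf hS hx] at this
  | allImp x φ ψ h =>
    refine ⟨_, subset_rfl, fun f hinl hf => .allImp x _ _ ?_⟩
    have hS : φ.vars ⊆ (((φ.imp ψ).all x).imp (φ.imp (ψ.all x))).vars := by
      intro v hv; simp [vars, hv]
    rwa [fv_map hinl hf hS, ← hinl x, mem_image_iff_of_injOn hf ((fv_subset_vars _).trans hS)]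
    simp [vars]
  | a2 t X y φ hX h =>
    refine ⟨_, subset_rfl, fun f hinl hf => ?_⟩
    have hS : φ.vars ⊆ ((jst t (insert y X) φ).imp (jst t X φ)).vars := by
      intro v hv; simp [vars, hv]
    have hS' : X ⊆ ((jst t (insert y X) φ).imp (jst t X φ)).vars := by
      intro v hv; simp [vars, hv]
    have hy : y ∈ ((jst t (insert y X) φ).imp (jst t X φ)).vars := by simp [vars]
    simp only [Fml.map, Finset.image_insert]
    refine .a2 t _ _ _ ?_ ?_
    · rwa [mem_image_iff_of_injOn hf hS' hy]
    · rwa [fv_map hinl hf hS, mem_image_iff_of_injOn hf ((fv_subset_vars _).trans hS) hy]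
  | a3 t X y φ hX =>
    refine ⟨_, subset_rfl, fun f hinl hf => ?_⟩
    have hS' : X ⊆ ((jst t X φ).imp (jst t (insert y X) φ)).vars := by
      intro v hv; simp [vars, hv]
    have hy : y ∈ ((jst t X φ).imp (jst t (insert y X) φ)).vars := by simp [vars]
    simp only [Fml.map, Finset.image_insert]
    exact .a3 t _ _ _ (by rwa [mem_image_iff_of_injOn hf hS' hy])
  | b1 t X φ => exact ⟨_, subset_rfl, fun _ _ _ => .b1 _ _ _⟩
  | b2 t s X φ ψ => exact ⟨_, subset_rfl, fun _ _ _ => .b2 _ _ _ _ _⟩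
  | b3l t s X φ => exact ⟨_, subset_rfl, fun _ _ _ => .b3l _ _ _ _⟩
  | b3r t s X φ => exact ⟨_, subset_rfl, fun _ _ _ => .b3r _ _ _ _⟩
  | b4 t X φ => exact ⟨_, subset_rfl, fun _ _ _ => .b4 _ _ _⟩
  | b5 t X x φ h =>
    refine ⟨_, subset_rfl, fun f hinl hf => .b5 _ _ _ _ ?_⟩
    rw [← hinl x, mem_image_iff_of_injOn hf _ _]
    · exact h
    · intro v hv; simp [vars, hv]
    · simp [vars]
  | b6 t X φ => exact ⟨_, subset_rfl, fun _ _ _ => .b6 _ _ _⟩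

/-- A witness is never quantified, and it could be hidden only by a subscript that omits it, which a
Henkin formula forbids. -/
theorem IsHenkin.nonfree {φ : Fml D} (h : φ.IsHenkin) {v : Var D} (hv : v ∈ φ.nonfree) :
    ∃ x, v = Sum.inl x := by
  induction φ with
  | rel n k args => simp [Fml.nonfree] at hv
  | bot => simp [Fml.nonfree] at hv
  | imp φ ψ ih1 ih2 =>
    exact (Finset.mem_union.1 hv).elim (ih1 h.1) (ih2 h.2)
  | all x φ ih => exact (Finset.mem_insert.1 hv).elim (fun h => ⟨x, h⟩) (ih h)
  | jst t X φ ih =>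
    rcases Finset.mem_union.1 hv with hv | hv
    · exact ih h.2 hv
    · rcases v with x | d
      · exact ⟨x, rfl⟩
      · rw [Finset.mem_sdiff] at hv
        exact absurd (Finset.mem_toRight.1 (h.1 (inr_mem_wit_of_mem_fv hv.1))) hv.2

open Classical in
/-- A Henkin axiom is a variable variant of an axiom of the basic language. -/
theorem _root_.FOJT45.IsAx.exists_variant [Countable D] {ψ : Fml D} (h : IsAx ψ) (hψ : ψ.IsHenkin) :
    ∃ φ : Fml Empty, IsAx φ ∧ VariableVariant φ.emb ψ := by
  obtain ⟨e, he⟩ := exists_injective_nat D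
  obtain ⟨S, hS, hax⟩ := h.map (D' := Empty)
  obtain ⟨N, hN⟩ : ∃ N, ∀ x, Sum.inl x ∈ S → x < N := by
    refine ⟨S.toLeft.sup id + 1, fun x hx => Nat.lt_succ_of_le ?_⟩
    exact Finset.le_sup (f := id) (Finset.mem_toLeft.2 hx)
  have hρ : Function.Injective fun d => N + e d := fun a b hab => he (by simpa using hab)
  -- witnesses are exchanged with basic variables from `N` on
  let f : Var D → Var Empty := Sum.elim Sum.inl fun d => Sum.inl (N + e d)
  -- A variant requires a permutation of all variables, so the way back from `f` is completed to the
  -- involution that swaps each witness `d` with `N + e d`.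
  let τ : Var D → Var D := Sum.elim
    (fun x => if hx : ∃ d, N + e d = x then Sum.inr hx.choose else Sum.inl x)
    (fun d => Sum.inl (N + e d))
  have τinr : ∀ d, τ (Sum.inr d) = Sum.inl (N + e d) := fun d => rfl
  have τfresh : ∀ d, τ (Sum.inl (N + e d)) = Sum.inr d := fun d => by
    have hd : ∃ d', N + e d' = N + e d := ⟨d, rfl⟩
    simp only [τ, Sum.elim_inl, dif_pos hd]
    rw [hρ hd.choose_spec]
  have τother : ∀ x, (¬ ∃ d, N + e d = x) → τ (Sum.inl x) = Sum.inl x := fun x hx => by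
    simp only [τ, Sum.elim_inl, dif_neg hx]
  have τinv : Function.Involutive τ := by
    rintro (x | d)
    · by_cases hx : ∃ d, N + e d = x
      · obtain ⟨d, rfl⟩ := hx
        rw [τfresh, τinr]
      · rw [τother x hx, τother x hx]
    · rw [τinr, τfresh]
  have τold : ∀ x, Sum.inl x ∈ S → τ (Sum.inl x) = Sum.inl x := fun x hx =>
    τother x (by rintro ⟨d, rfl⟩; exact absurd (hN _ hx) (by omega))
  let g : Var D → Var D := Sum.map id Empty.elim ∘ f
  have τg : ∀ v ∈ S, τ (g v) = v := by
    rintro (x | d) hv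
    · exact τold x hv
    · exact τfresh d
  have hg : Set.InjOn g S := fun u hu v hv huv => by
    rw [← τg u hu, ← τg v hv, huv]
  have hf : Set.InjOn f S := fun u hu v hv huv => hg hu hv (congrArg (Sum.map id Empty.elim) huv)
  refine ⟨ψ.map f, hax f (fun _ => rfl) hf, τinv.toPerm, ?_, ?_⟩
  · intro v hv
    rw [emb_map, nonfree_map (fun _ => rfl) hg hS] at hv
    obtain ⟨u, hu, rfl⟩ := Finset.mem_image.1 hv
    obtain ⟨x, rfl⟩ := hψ.nonfree hu
    exact τold x (hS (nonfree_subset_vars _ hu))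
  · rw [subst_eq_map_of_nonfree, emb_map]
    · exact map_map_eq_self _ fun v hv => τg v (hS hv)
    · intro v hv
      rw [emb_map, nonfree_map (fun _ => rfl) hg hS] at hv
      obtain ⟨u, hu, rfl⟩ := Finset.mem_image.1 hv
      obtain ⟨x, rfl⟩ := hψ.nonfree hu
      exact τold x (hS (nonfree_subset_vars _ hu))

end Formulas

end Fml

/-! ### Derivability by modus ponens, internalization, and elimination of generalization. -/

section Derivations

variable {V : Type u} [DecidableEq V] {CS : Set (Fml Empty)} {Γ Δ : Set (Fml V)}
  {φ ψ θ χ : Fml V}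

theorem isHenkin_of_mem_extend (h : φ ∈ (extend CS : Set (Fml V))) : φ.IsHenkin := by
  obtain ⟨c, φ, ψ, -, hψ, -, rfl⟩ := h
  exact ⟨fun d hd => by simpa [witSet] using hd, hψ⟩

theorem IsHenkin.jst_witSet (h : φ.IsHenkin) (t : Term) : (jst t φ.witSet φ).IsHenkin :=
  ⟨fun d hd => by simpa [witSet] using hd, h⟩

theorem toRight_witSet (φ : Fml V) : φ.witSet.toRight = φ.wit := by
  ext d; simp [witSet]

theorem inl_notMem_witSet (x : ℕ) (φ : Fml V) : Sum.inl x ∉ φ.witSet := by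
  simp [witSet]

theorem inr_mem_witSet {d : V} : Sum.inr d ∈ φ.witSet ↔ d ∈ φ.wit := by
  simp [witSet]

/-- Derivability by modus ponens alone, from postulates and Henkin premises. -/
inductive Der (CS : Set (Fml Empty)) (Γ : Set (Fml V)) : Fml V → Prop
  | ax {φ : Fml V} (hφ : φ.IsHenkin) (h : IsAx φ) : Der CS Γ φ
  | spec {φ : Fml V} (h : φ ∈ (extend CS : Set (Fml V))) : Der CS Γ φ
  | hyp {φ : Fml V} (hφ : φ.IsHenkin) (h : φ ∈ Γ) : Der CS Γ φ
  | mp {φ ψ : Fml V} (h₁ : Der CS Γ φ) (h₂ : Der CS Γ (imp φ ψ)) : Der CS Γ ψ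

namespace Der

theorem henkin (h : Der CS Γ φ) : φ.IsHenkin := by
  induction h with
  | ax hφ _ => exact hφ
  | spec h => exact isHenkin_of_mem_extend h
  | hyp hφ _ => exact hφ
  | mp _ _ _ ih => exact ih.2

theorem cut (h : Der CS Δ ψ) (hΔ : ∀ φ ∈ Δ, φ.IsHenkin → Der CS Γ φ) : Der CS Γ ψ := by
  induction h with
  | ax hφ h => exact .ax hφ h
  | spec h => exact .spec h
  | hyp hφ h => exact hΔ _ h hφ
  | mp _ _ ih1 ih2 => exact .mp ih1 ih2

theorem mono (h : Der CS Δ ψ) (hΔ : Δ ⊆ Γ) : Der CS Γ ψ :=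
  h.cut fun _ hφ hH => .hyp hH (hΔ hφ)

theorem imp_intro_of (hφ : φ.IsHenkin) (h : Der CS Γ ψ) : Der CS Γ (imp φ ψ) :=
  .mp h (.ax ⟨h.henkin, hφ, h.henkin⟩ (.k _ _))

theorem imp_self (hφ : φ.IsHenkin) : Der CS Γ (imp φ φ) :=
  .mp (.ax (φ := imp φ (imp φ φ)) ⟨hφ, hφ, hφ⟩ (.k φ φ))
    (.mp (.ax (φ := imp φ (imp (imp φ φ) φ)) ⟨hφ, ⟨hφ, hφ⟩, hφ⟩ (.k φ (imp φ φ)))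
      (.ax ⟨⟨hφ, ⟨hφ, hφ⟩, hφ⟩, ⟨hφ, hφ, hφ⟩, hφ, hφ⟩ (.s φ (imp φ φ) φ)))

/-- The deduction theorem. -/
theorem imp_intro (hφ : φ.IsHenkin) (h : Der CS (insert φ Γ) ψ) : Der CS Γ (imp φ ψ) := by
  induction h with
  | ax hψ h => exact imp_intro_of hφ (.ax hψ h)
  | spec h => exact imp_intro_of hφ (.spec h)
  | hyp hψ h =>
    rcases h with rfl | h
    · exact imp_self hφ
    · exact imp_intro_of hφ (.hyp hψ h)
  | mp _ _ ih1 ih2 =>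
    have h1 := ih1.henkin
    have h2 := ih2.henkin
    exact .mp ih1 (.mp ih2 (.ax ⟨h2, h1, hφ, h2.2.2⟩ (.s _ _ _)))

theorem hyp_insert (hφ : φ.IsHenkin) : Der CS (insert φ Γ) φ := .hyp hφ (Set.mem_insert _ _)

theorem insert (h : Der CS Γ ψ) : Der CS (insert φ Γ) ψ := h.mono (Set.subset_insert _ _)

theorem of_neg_neg (h : Der CS Γ (neg (neg φ))) : Der CS Γ φ :=
  .mp h (.ax ⟨h.henkin, h.henkin.1.1⟩ (.dne _))

theorem exfalso (h : Der CS Γ bot) (hφ : φ.IsHenkin) : Der CS Γ φ :=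
  of_neg_neg (imp_intro_of (φ := neg φ) ⟨hφ, trivial⟩ h)

theorem by_contra (hφ : φ.IsHenkin) (h : Der CS (Insert.insert (neg φ) Γ) bot) : Der CS Γ φ :=
  of_neg_neg (imp_intro (φ := neg φ) ⟨hφ, trivial⟩ h)

theorem or_inl (h : Der CS Γ ψ) (hθ : θ.IsHenkin) : Der CS Γ (ψ.or θ) :=
  imp_intro (φ := neg ψ) ⟨h.henkin, trivial⟩
    (exfalso (.mp h.insert (hyp_insert ⟨h.henkin, trivial⟩)) hθ)

theorem or_inr (h : Der CS Γ θ) (hψ : ψ.IsHenkin) : Der CS Γ (ψ.or θ) :=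
  imp_intro_of (φ := neg ψ) ⟨hψ, trivial⟩ h

theorem not_or (h₁ : Der CS Γ (neg ψ)) (h₂ : Der CS Γ (neg θ)) : Der CS Γ (neg (ψ.or θ)) := by
  have h : (ψ.or θ).IsHenkin := ⟨h₁.henkin, h₂.henkin.1⟩
  exact imp_intro h (.mp (.mp h₁.insert (hyp_insert h)) h₂.insert)

theorem imp_trans (h₁ : Der CS Γ (imp φ ψ)) (h₂ : Der CS Γ (imp ψ θ)) : Der CS Γ (imp φ θ) :=
  imp_intro h₁.henkin.1 (.mp (.mp (hyp_insert h₁.henkin.1) h₁.insert) h₂.insert)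

theorem contrapose (h : Der CS Γ (imp φ ψ)) : Der CS Γ (imp (neg ψ) (neg φ)) :=
  have hφ := h.henkin.1
  have hψ := h.henkin.2
  imp_intro (φ := neg ψ) ⟨hψ, trivial⟩ (imp_intro hφ (.mp
    (.mp (hyp_insert hφ) h.insert.insert) (hyp_insert (φ := neg ψ) ⟨hψ, trivial⟩).insert))

theorem or_imp_or {ψ' θ' : Fml V} (h₁ : Der CS Γ (imp ψ ψ')) (h₂ : Der CS Γ (imp θ θ')) :
    Der CS Γ (imp (ψ.or θ) (ψ'.or θ')) := by
  have h : (ψ.or θ).IsHenkin := ⟨⟨h₁.henkin.1, trivial⟩, h₂.henkin.1⟩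
  exact imp_intro h (imp_trans h₁.contrapose.insert (imp_trans (hyp_insert h) h₂.insert))

theorem jst_union {t : Term} {X : Finset (Var V)} (h : Der CS Γ (jst t X φ))
    (Z : Finset (Var V)) : Der CS Γ (jst t (X ∪ Z) φ) := by
  induction Z using Finset.induction_on with
  | empty => simpa using h
  | insert y Z _ ih =>
    rw [Finset.union_insert]
    by_cases hy : y ∈ X ∪ Z
    · rwa [Finset.insert_eq_of_mem hy]
    · refine .mp ih (.ax ⟨ih.henkin, ?_, h.henkin.2⟩ (.a3 _ _ _ _ hy))
      exact ih.henkin.1.trans fun d hd => by simp at hd ⊢; tauto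

/-- Variables are dropped one at a time by `a2`; `hX` keeps the intermediate formulas Henkin, as is
needed for the instances of `a2` to count as axioms. -/
theorem jst_of_union {t : Term} {X Z : Finset (Var V)} (h : Der CS Γ (jst t (X ∪ Z) φ))
    (hX : φ.wit ⊆ X.toRight) (hZ : ∀ y ∈ Z, y ∉ φ.fv) : Der CS Γ (jst t X φ) := by
  induction Z using Finset.induction_on with
  | empty => simpa using h
  | insert y Z _ ih =>
    refine ih ?_ fun z hz => hZ z (Finset.mem_insert_of_mem hz)
    rw [Finset.union_insert] at h
    by_cases hy : y ∈ X ∪ Z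
    · rwa [Finset.insert_eq_of_mem hy] at h
    · refine .mp h (.ax ⟨h.henkin, ?_, h.henkin.2⟩
        (.a2 _ _ _ _ hy (hZ y (Finset.mem_insert_self _ _))))
      exact hX.trans fun d hd => by simp at hd ⊢; tauto

/-- Over subscript sets without basic variables, justification assertions are equivalent to those
with the least possible subscript. -/
theorem jst_witSet_iff {t : Term} {X : Finset (Var V)} (hX : φ.wit ⊆ X.toRight)
    (hXcl : ∀ x, Sum.inl x ∉ X) :
    Der CS Γ (jst t X φ) ↔ Der CS Γ (jst t φ.witSet φ) := by
  have hsub : φ.witSet ∪ X \ φ.witSet = X := Finset.union_sdiff_of_subset fun v hv => by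
    obtain ⟨d, hd, rfl⟩ := Finset.mem_map.1 hv
    exact Finset.mem_toRight.1 (hX hd)
  constructor
  · intro h
    rw [← hsub] at h
    refine h.jst_of_union (by rw [toRight_witSet]) ?_
    rintro (x | d) hd hfv
    · exact hXcl x (Finset.mem_sdiff.1 hd).1
    · exact (Finset.mem_sdiff.1 hd).2 (inr_mem_witSet.2 (inr_mem_wit_of_mem_fv hfv))
  · intro h
    rw [← hsub]
    exact h.jst_union _

end Der

/-- Some justification of `φ` is derivable. -/
def Justified (CS : Set (Fml Empty)) (Γ : Set (Fml V)) (φ : Fml V) : Prop :=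
  ∃ t : Term, Der CS Γ (jst t φ.witSet φ)

namespace Justified

theorem ax [Countable V] (happ : AxiomaticallyAppropriate CS) (hφ : φ.IsHenkin) (h : IsAx φ) :
    Justified CS Γ φ := by
  obtain ⟨ψ, hψ, hvar⟩ := h.exists_variant hφ
  obtain ⟨c, hc⟩ := happ ψ hψ
  exact ⟨.const c, .spec ⟨c, ψ, φ, hc, hφ, hvar, rfl⟩⟩

/-- The member `c :_X ψ` is checked by `! c`. Its witnesses are just those of `ψ`, so the subscript
given by `b4` is the required one. -/
theorem spec (h : φ ∈ (extend CS : Set (Fml V))) : Justified CS Γ φ := by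
  have hH := isHenkin_of_mem_extend h
  have hD : Der CS Γ φ := .spec h
  obtain ⟨c, φ, ψ, -, hψ, -, rfl⟩ := h
  have : (jst (Term.const c) ψ.witSet ψ).wit = ψ.wit := by
    simp [wit, toRight_witSet]
  refine ⟨.bang (.const c), ?_⟩
  rw [witSet, this]
  refine .mp hD (.ax ⟨hH, ?_, hH⟩ (.b4 _ _ _))
  exact Finset.union_subset subset_rfl (toRight_witSet ψ).ge

/-- Application needs equal subscripts: that of `φ` is enlarged to the witnesses of `φ → ψ`, and
after `b2` the result is cut down to the witnesses of `ψ`. -/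
theorem mp (h₁ : Justified CS Γ φ) (h₂ : Justified CS Γ (imp φ ψ)) : Justified CS Γ ψ := by
  obtain ⟨s, hs⟩ := h₁
  obtain ⟨t, ht⟩ := h₂
  have hw : (imp φ ψ).witSet = φ.witSet ∪ ψ.witSet := by
    simp [witSet, wit, Finset.map_union]
  have hs' := hs.jst_union ψ.witSet
  rw [← hw] at hs'
  have hψ : (jst (.app t s) (imp φ ψ).witSet ψ).IsHenkin := by
    refine ⟨?_, ht.henkin.2.2⟩
    rw [toRight_witSet]
    exact Finset.subset_union_right
  exact ⟨.app t s, (Der.jst_witSet_iff hψ.1 fun x => inl_notMem_witSet x _).1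
    (.mp hs' (.mp ht (.ax ⟨ht.henkin, hs'.henkin, hψ⟩ (.b2 _ _ _ _ _))))⟩

/-- The least subscript contains no basic variable, so `b5` always applies, and quantifying leaves
the set of witnesses unchanged. -/
theorem all (h : Justified CS Γ φ) (x : ℕ) : Justified CS Γ (all x φ) := by
  obtain ⟨t, ht⟩ := h
  exact ⟨.gen x t, .mp ht (.ax ⟨ht.henkin, ht.henkin.1, ht.henkin.2⟩
    (.b5 _ _ _ _ (inl_notMem_witSet x φ)))⟩

theorem alls (h : Justified CS Γ φ) (ys : List ℕ) : Justified CS Γ (alls ys φ) := by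
  induction ys with
  | nil => exact h
  | cons y ys ih => exact ih.all y

theorem der (h : Justified CS Γ φ) : Der CS Γ φ := by
  obtain ⟨t, ht⟩ := h
  exact .mp ht (.ax ⟨ht.henkin, ht.henkin.2⟩ (.b1 _ _ _))

variable [Countable V]

/-- Internalization: a derivation is copied step by step into a justification term, with
justifications of the premises at the leaves. -/
theorem of_der (happ : AxiomaticallyAppropriate CS) (h : Der CS Δ ψ)
    (hΔ : ∀ φ ∈ Δ, φ.IsHenkin → Justified CS Γ φ) : Justified CS Γ ψ := by
  induction h with
  | ax hφ h => exact ax happ hφ h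
  | spec h => exact spec h
  | hyp hφ h => exact hΔ _ h hφ
  | mp _ _ ih1 ih2 => exact ih1.mp ih2

/-- Generalization is internalized by `gen x`. Combined with `Justified.der`, this shows that
theorems need no generalization rule. -/
theorem of_deriv (happ : AxiomaticallyAppropriate CS) (h : Deriv (extend CS) ∅ φ) :
    Justified CS Γ φ := by
  induction h with
  | ax hφ h => exact ax happ hφ h
  | spec h => exact spec h
  | hyp h => exact absurd h (Set.notMem_empty _)
  | mp _ _ ih1 ih2 => exact ih1.mp ih2
  | gen x _ _ ih => exact ih.all x

end Justified

theorem Der.deriv (h : Der CS Γ φ) : Deriv (extend CS) Γ φ := by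
  induction h with
  | ax hφ h => exact .ax hφ h
  | spec h => exact .spec h
  | hyp _ h => exact .hyp h
  | mp _ _ ih1 ih2 => exact .mp ih1 ih2

theorem Deriv.henkin (h : Deriv (extend CS) Γ φ) (hΓ : ∀ ψ ∈ Γ, ψ.IsHenkin) : φ.IsHenkin := by
  induction h with
  | ax hφ h => exact hφ
  | spec h => exact isHenkin_of_mem_extend h
  | hyp h => exact hΓ _ h
  | mp _ _ _ ih => exact ih.2
  | gen x _ _ ih => exact ih

/-- The deduction theorem in the presence of the generalization rule. -/
theorem Deriv.imp_intro (hΓ : ∀ ψ ∈ Γ, ψ.IsHenkin) (hφ : φ.IsHenkin)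
    (h : Deriv (extend CS) (insert φ Γ) ψ) : Deriv (extend CS) Γ (imp φ ψ) := by
  have weaken : ∀ {χ}, χ.IsHenkin → Deriv (extend CS) Γ χ → Deriv (extend CS) Γ (imp φ χ) :=
    fun hχ h => .mp h (.ax ⟨hχ, hφ, hχ⟩ (.k _ _))
  induction h with
  | ax hψ h => exact weaken hψ (.ax hψ h)
  | spec h => exact weaken (isHenkin_of_mem_extend h) (.spec h)
  | hyp h =>
    rcases h with rfl | h
    · exact ((Der.imp_self hφ).deriv : Deriv (extend CS) Γ _)
    · exact weaken (hΓ _ h) (.hyp h)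
  | mp _ _ ih1 ih2 =>
    have h2 := ih2.henkin hΓ
    exact .mp ih1 (.mp ih2 (.ax ⟨h2, ih1.henkin hΓ, hφ, h2.2.2⟩ (.s _ _ _)))
  | gen x hx _ ih =>
    have h := ih.henkin hΓ
    exact .mp (.gen x (fun χ hχ => hx χ (Set.mem_insert_of_mem _ hχ)) ih)
      (.ax ⟨h, h⟩ (.allImp x _ _ (hx φ (Set.mem_insert _ _))))

/-- The finitely many premises are discharged by the deduction theorem, the resulting theorem is
freed of generalization, and the premises are restored by modus ponens. -/
theorem Der.of_deriv [Countable V] (happ : AxiomaticallyAppropriate CS) (hfin : Γ.Finite)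
    (hΓ : ∀ ψ ∈ Γ, ψ.IsHenkin) (h : Deriv (extend CS) Γ φ) : Der CS Γ φ := by
  induction Γ, hfin using Set.Finite.induction_on generalizing φ with
  | empty => exact (Justified.of_deriv happ h).der
  | @insert ψ Γ _ _ ih =>
    have hψ := hΓ ψ (Set.mem_insert _ _)
    have hΓ' : ∀ ψ ∈ Γ, ψ.IsHenkin := fun χ hχ => hΓ χ (Set.mem_insert_of_mem _ hχ)
    exact .mp (.hyp_insert hψ) (ih hΓ' (h.imp_intro hΓ' hψ)).insert

theorem Der.exists_finite (h : Der CS Γ φ) : ∃ Γ₀ ⊆ Γ, Γ₀.Finite ∧ Der CS Γ₀ φ := by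
  induction h with
  | ax hφ h => exact ⟨∅, Set.empty_subset _, Set.finite_empty, .ax hφ h⟩
  | spec h => exact ⟨∅, Set.empty_subset _, Set.finite_empty, .spec h⟩
  | @hyp φ hφ h =>
    exact ⟨{φ}, Set.singleton_subset_iff.2 h, Set.finite_singleton _, .hyp hφ rfl⟩
  | mp _ _ ih1 ih2 =>
    obtain ⟨A, hA, hAf, h1⟩ := ih1
    obtain ⟨B, hB, hBf, h2⟩ := ih2
    exact ⟨A ∪ B, Set.union_subset hA hB, hAf.union hBf,
      .mp (h1.mono Set.subset_union_left) (h2.mono Set.subset_union_right)⟩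

theorem consistent_iff [Countable V] (happ : AxiomaticallyAppropriate CS)
    (hΓ : ∀ ψ ∈ Γ, ψ.IsHenkin) : Consistent (extend CS) Γ ↔ ¬ Der CS Γ bot := by
  refine not_congr ⟨?_, fun h => ?_⟩
  · rintro ⟨Γ₀, hsub, hfin, h⟩
    exact (Der.of_deriv happ hfin (fun ψ hψ => hΓ ψ (hsub hψ)) h).mono hsub
  · obtain ⟨Γ₀, hsub, hfin, h⟩ := h.exists_finite
    exact ⟨Γ₀, hsub, hfin, h.deriv⟩

end Derivations

/-! ### Instantiation sets of templates -/

namespace Template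

variable {V : Type u} [DecidableEq V] {CS : Set (Fml Empty)} {Γ : Set (Fml V)}

theorem inst_nonempty (e : ℕ → Fml V) (F : Template) : (F.inst e).Nonempty := by
  induction F with
  | letter i => exact ⟨_, rfl⟩
  | neg F ih => exact ⟨_, _, ih.choose_spec, rfl⟩
  | or F G ih1 ih2 => exact ⟨_, _, ih1.choose_spec, _, ih2.choose_spec, rfl⟩
  | and F G ih1 ih2 => exact ⟨_, _, ih1.choose_spec, _, ih2.choose_spec, rfl⟩
  | box F ih => exact ⟨_, _, ih.choose_spec, .var 0, rfl⟩

theorem inst_congr {e e' : ℕ → Fml V} {F : Template} (h : ∀ i ∈ F.letters, e i = e' i) :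
    F.inst e = F.inst e' := by
  induction F with
  | letter i => simp only [inst, h i (by simp [letters])]
  | neg F ih => simp only [inst, ih h]
  | or F G ih1 ih2 =>
    simp only [letters, List.mem_append] at h
    simp only [inst, ih1 fun i hi => h i (.inl hi), ih2 fun i hi => h i (.inr hi)]
  | and F G ih1 ih2 =>
    simp only [letters, List.mem_append] at h
    simp only [inst, ih1 fun i hi => h i (.inl hi), ih2 fun i hi => h i (.inr hi)]
  | box F ih => simp only [inst, ih h]

theorem isHenkin_of_mem_inst {e : ℕ → Fml V} (he : ∀ i, (e i).IsHenkin) {F : Template}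
    {ψ : Fml V} (h : ψ ∈ F.inst e) : ψ.IsHenkin := by
  induction F generalizing ψ with
  | letter i => exact h ▸ he i
  | neg F ih =>
    obtain ⟨ψ, hψ, rfl⟩ := h
    exact ⟨ih hψ, trivial⟩
  | or F G ih1 ih2 =>
    obtain ⟨ψ, hψ, θ, hθ, rfl⟩ := h
    exact ⟨⟨ih1 hψ, trivial⟩, ih2 hθ⟩
  | and F G ih1 ih2 =>
    obtain ⟨ψ, hψ, θ, hθ, rfl⟩ := h
    exact ⟨⟨ih1 hψ, ih2 hθ, trivial⟩, trivial⟩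
  | box F ih =>
    obtain ⟨ψ, hψ, t, rfl⟩ := h
    exact IsHenkin.jst_witSet (ih hψ) t

/-- Addition of `k` to all letters. -/
def shift (k : ℕ) : Template → Template
  | letter i => letter (i + k)
  | neg F => neg (F.shift k)
  | or F G => or (F.shift k) (G.shift k)
  | and F G => and (F.shift k) (G.shift k)
  | box F => box (F.shift k)

theorem letters_shift (k : ℕ) (F : Template) : (F.shift k).letters = F.letters.map (· + k) := by
  induction F <;> simp_all [shift, letters]

theorem onlyOr_shift {k : ℕ} {F : Template} (h : F.OnlyOr) : (F.shift k).OnlyOr := by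
  induction F <;> simp_all [shift, OnlyOr]

theorem inst_shift (k : ℕ) (e : ℕ → Fml V) (F : Template) :
    (F.shift k).inst e = F.inst fun i => e (i + k) := by
  induction F <;> simp_all [shift, inst]

theorem IsDisjunctive.shift {F : Template} (h : F.IsDisjunctive) (k : ℕ) :
    (F.shift k).IsDisjunctive := by
  refine ⟨?_, onlyOr_shift h.2⟩
  rw [letters_shift]
  exact h.1.map (add_left_injective k)

/-- Instantiation sets of disjunctive templates are directed upwards under provable implication. -/
theorem exists_join [Countable V] (happ : AxiomaticallyAppropriate CS) {e : ℕ → Fml V}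
    (he : ∀ i, (e i).IsHenkin) {F : Template} (hF : F.OnlyOr) {ψ₁ ψ₂ : Fml V}
    (h₁ : ψ₁ ∈ F.inst e) (h₂ : ψ₂ ∈ F.inst e) :
    ∃ ψ ∈ F.inst e, Der CS ∅ (imp ψ₁ ψ) ∧ Der CS ∅ (imp ψ₂ ψ) := by
  induction F generalizing ψ₁ ψ₂ with
  | letter i =>
    obtain rfl : ψ₁ = e i := h₁
    obtain rfl : ψ₂ = e i := h₂
    exact ⟨_, rfl, .imp_self (he i), .imp_self (he i)⟩
  | neg F ih => exact hF.elim
  | or F G ih1 ih2 =>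
    obtain ⟨ψ₁, hψ₁, θ₁, hθ₁, rfl⟩ := h₁
    obtain ⟨ψ₂, hψ₂, θ₂, hθ₂, rfl⟩ := h₂
    obtain ⟨ψ, hψ, a1, a2⟩ := ih1 hF.1 hψ₁ hψ₂
    obtain ⟨θ, hθ, b1, b2⟩ := ih2 hF.2 hθ₁ hθ₂
    exact ⟨_, ⟨ψ, hψ, θ, hθ, rfl⟩, a1.or_imp_or b1, a2.or_imp_or b2⟩
  | and F G ih1 ih2 => exact hF.elim
  | box F ih =>
    obtain ⟨ψ₁, hψ₁, t₁, rfl⟩ := h₁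
    obtain ⟨ψ₂, hψ₂, t₂, rfl⟩ := h₂
    obtain ⟨ψ, hψ, a1, a2⟩ := ih hF hψ₁ hψ₂
    -- The box is monotone in this sense: the provable implication is internalized and applied to
    -- the justification of its antecedent.
    have key : ∀ χ t, Der CS ∅ (imp χ ψ) →
        ∃ s, Der CS ∅ (imp (jst t χ.witSet χ) (jst s ψ.witSet ψ)) := by
      intro χ t h
      have hj := IsHenkin.jst_witSet h.henkin.1 t
      obtain ⟨s, hs⟩ := Justified.mp (Γ := insert (jst t χ.witSet χ) ∅) ⟨t, .hyp_insert hj⟩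
        (.of_der happ h fun _ h => absurd h (Set.notMem_empty _))
      exact ⟨s, .imp_intro hj hs⟩
    obtain ⟨s₁, c1⟩ := key ψ₁ t₁ a1
    obtain ⟨s₂, c2⟩ := key ψ₂ t₂ a2
    have hH := IsHenkin.jst_witSet (isHenkin_of_mem_inst he hψ)
    -- The sum inherits the evidence of both terms, which is what makes the boxed set directed.
    exact ⟨_, ⟨ψ, hψ, .sum s₁ s₂, rfl⟩,
      c1.imp_trans (.ax ⟨hH _, hH _⟩ (.b3l _ _ _ _)),
      c2.imp_trans (.ax ⟨hH _, hH _⟩ (.b3r _ _ _ _))⟩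

/-- Directedness merges the premises `¬ψ` used in a derivation into one: if `ψ₁` and `ψ₂` imply `ψ`,
then `¬ψ` implies `¬ψ₁` and `¬ψ₂`. A contradiction from `¬ψ` then yields `ψ`. -/
theorem exists_der_of_der_bot [Countable V] (happ : AxiomaticallyAppropriate CS) {e : ℕ → Fml V}
    (he : ∀ i, (e i).IsHenkin) {F : Template} (hF : F.OnlyOr)
    (h : Der CS (Γ ∪ (neg F).inst e) bot) : ∃ ψ ∈ F.inst e, Der CS Γ ψ := by
  have key : ∀ χ, Der CS (Γ ∪ (neg F).inst e) χ →
      ∃ ψ ∈ F.inst e, Der CS Γ (imp ψ.neg χ) := by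
    intro χ h
    have triv : ∀ {χ}, Der CS Γ χ → ∃ ψ ∈ F.inst e, Der CS Γ (imp ψ.neg χ) := fun h =>
      have ⟨ψ, hψ⟩ := F.inst_nonempty e
      ⟨ψ, hψ, .imp_intro_of ⟨isHenkin_of_mem_inst he hψ, trivial⟩ h⟩
    induction h with
    | ax hφ h => exact triv (.ax hφ h)
    | spec h => exact triv (.spec h)
    | hyp hφ h =>
      rcases h with h | ⟨ψ, hψ, rfl⟩
      · exact triv (.hyp hφ h)
      · exact ⟨ψ, hψ, .imp_self hφ⟩
    | mp _ _ ih1 ih2 =>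
      obtain ⟨ψ₁, h1, d1⟩ := ih1
      obtain ⟨ψ₂, h2, d2⟩ := ih2
      obtain ⟨ψ, hψ, c1, c2⟩ := exists_join happ he hF h1 h2
      have hH : ψ.neg.IsHenkin := ⟨isHenkin_of_mem_inst he hψ, trivial⟩
      have c1' := (c1.mono (Set.empty_subset Γ)).contrapose.imp_trans d1
      have c2' := (c2.mono (Set.empty_subset Γ)).contrapose.imp_trans d2
      exact ⟨ψ, hψ, .imp_intro hH (.mp (.mp (.hyp_insert hH) c1'.insert)
        (.mp (.hyp_insert hH) c2'.insert))⟩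
  obtain ⟨ψ, hψ, h⟩ := key _ h
  exact ⟨ψ, hψ, h.of_neg_neg⟩

end Template

namespace Fml

/-! ### Substitution of witnesses for basic variables. -/

section Witnesses

variable {V : Type u} [DecidableEq V] {φ ψ : Fml V}

theorem FreeFor.self (x : ℕ) (φ : Fml V) : φ.FreeFor (Sum.inl x) x := by
  induction φ with
  | rel n k args => trivial
  | bot => trivial
  | imp φ ψ ih1 ih2 => exact ⟨ih1, ih2⟩
  | all z φ ih =>
    by_cases h : x = z
    · left; simp [fv, h]
    · exact .inr ⟨fun h' => h (Sum.inl.inj h'), ih⟩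
  | jst t X φ ih =>
    by_cases h : Sum.inl x ∈ X
    · exact .inr ⟨ih, fun _ => h⟩
    · exact .inl h

theorem subst1_self (x : ℕ) (φ : Fml V) : φ.subst1 x (Sum.inl x) = φ := by
  have : Function.update id (Sum.inl x : Var V) (Sum.inl x) = id := Function.update_eq_self _ _
  rw [subst1, this, subst_id]

/-- Quantifiers cannot capture a witness, and a subscript contains every witness that occurs below
it. -/
theorem IsHenkin.freeFor (h : φ.IsHenkin) (a : V) (x : ℕ) : φ.FreeFor (Sum.inr a) x := by
  induction φ with
  | rel n k args => trivial
  | bot => trivial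
  | imp φ ψ ih1 ih2 => exact ⟨ih1 h.1, ih2 h.2⟩
  | all z φ ih => exact .inr ⟨Sum.inr_ne_inl, ih h⟩
  | jst t X φ ih =>
    exact .inr ⟨ih h.2, fun ha => Finset.mem_toRight.1 (h.1 (inr_mem_wit_of_mem_fv ha))⟩

/-- Replacements of some basic variables by witnesses. -/
def IsWitnessing (σ : Var V → Var V) : Prop :=
  ∀ v, σ v = v ∨ ∃ x d, v = Sum.inl x ∧ σ v = Sum.inr d

omit [DecidableEq V] in
theorem IsWitnessing.inr {σ : Var V → Var V} (h : IsWitnessing σ) (d : V) :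
    σ (Sum.inr d) = Sum.inr d := by
  rcases h (Sum.inr d) with h | ⟨x, _, h, -⟩
  · exact h
  · cases h

theorem IsWitnessing.update {σ : Var V → Var V} (h : IsWitnessing σ) (x : ℕ) :
    IsWitnessing (Function.update σ (Sum.inl x) (Sum.inl x)) := fun v => by
  by_cases hv : v = Sum.inl x
  · simp [hv]
  · rw [Function.update_of_ne hv]; exact h v

theorem IsWitnessing.ite {σ : Var V → Var V} (h : IsWitnessing σ) (X : Finset (Var V)) :
    IsWitnessing fun v => if v ∈ X then σ v else v := fun v => by
  by_cases hv : v ∈ X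
  · simpa [hv] using h v
  · simp [hv]

theorem isWitnessing_update_id (x : ℕ) (a : V) :
    IsWitnessing (Function.update id (Sum.inl x) (Sum.inr a) : Var V → Var V) := fun v => by
  by_cases hv : v = Sum.inl x
  · exact .inr ⟨x, a, hv, by simp [hv]⟩
  · left; rw [Function.update_of_ne hv]; rfl

theorem fv_subst_subset (σ : Var V → Var V) (φ : Fml V) : (φ.subst σ).fv ⊆ φ.fv.image σ := by
  induction φ generalizing σ with
  | rel n k args => simp only [subst, fv, Finset.image_image]; exact subset_rfl
  | bot => exact subset_rfl
  | imp φ ψ ih1 ih2 =>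
    simp only [subst, fv, Finset.image_union]
    exact Finset.union_subset_union (ih1 σ) (ih2 σ)
  | all x φ ih =>
    intro v hv
    simp only [subst, fv, Finset.mem_erase] at hv
    obtain ⟨u, hu, rfl⟩ := Finset.mem_image.1 (ih _ hv.2)
    have hux : u ≠ Sum.inl x := fun h => hv.1 (by simp [h])
    rw [Function.update_of_ne hux]
    exact Finset.mem_image_of_mem σ (Finset.mem_erase.2 ⟨hux, hu⟩)
  | jst t X φ ih => exact subset_rfl

theorem wit_subst {σ : Var V → Var V} (hσ : IsWitnessing σ) (h : φ.IsHenkin) {d : V}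
    (hd : d ∈ (φ.subst σ).wit) : d ∈ φ.wit ∨ ∃ v ∈ φ.fv, σ v = Sum.inr d := by
  induction φ generalizing σ with
  | rel n k args =>
    simp only [subst, wit, Finset.mem_toRight, Finset.mem_image, Finset.mem_univ, true_and] at hd
    obtain ⟨i, hi⟩ := hd
    exact .inr ⟨args i, by simp [fv], hi⟩
  | bot => simp [subst, wit] at hd
  | imp φ ψ ih1 ih2 =>
    simp only [wit, fv, subst, Finset.mem_union] at hd ⊢
    rcases hd with hd | hd
    · rcases ih1 hσ h.1 hd with h | ⟨v, hv, h⟩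
      · exact .inl (.inl h)
      · exact .inr ⟨v, .inl hv, h⟩
    · rcases ih2 hσ h.2 hd with h | ⟨v, hv, h⟩
      · exact .inl (.inr h)
      · exact .inr ⟨v, .inr hv, h⟩
  | all x φ ih =>
    rcases ih (hσ.update x) h hd with h | ⟨v, hv, h⟩
    · exact .inl h
    · have hvx : v ≠ Sum.inl x := fun h' => by simp [h'] at h
      rw [Function.update_of_ne hvx] at h
      exact .inr ⟨v, Finset.mem_erase.2 ⟨hvx, hv⟩, h⟩
  | jst t X φ ih =>
    simp only [wit, fv, subst, Finset.mem_union, Finset.mem_toRight, Finset.mem_image] at hd ⊢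
    rcases hd with hd | hd
    · exact .inr hd
    · rcases ih (hσ.ite X) h.2 hd with h | ⟨v, hv, h⟩
      · exact .inl (.inr h)
      · split_ifs at h with hX
        · exact .inr ⟨v, hX, h⟩
        · exact .inl (.inr (inr_mem_wit_of_mem_fv (h ▸ hv)))

theorem IsHenkin.subst {σ : Var V → Var V} (hσ : IsWitnessing σ) (h : φ.IsHenkin) :
    (φ.subst σ).IsHenkin := by
  induction φ generalizing σ with
  | rel n k args => trivial
  | bot => trivial
  | imp φ ψ ih1 ih2 => exact ⟨ih1 hσ h.1, ih2 hσ h.2⟩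
  | all x φ ih => exact ih (hσ.update x) h
  | jst t X φ ih =>
    refine ⟨fun d hd => ?_, ih (hσ.ite X) h.2⟩
    rw [Finset.mem_toRight, Finset.mem_image]
    have hwit : ∀ d ∈ φ.wit, ∃ v ∈ X, σ v = Sum.inr d := fun d hd =>
      ⟨_, Finset.mem_toRight.1 (h.1 hd), hσ.inr d⟩
    rcases wit_subst (hσ.ite X) h.2 hd with h' | ⟨v, hv, h'⟩
    · exact hwit d h'
    · split_ifs at h' with hX
      · exact ⟨v, hX, h'⟩
      · exact hwit d (inr_mem_wit_of_mem_fv (h' ▸ hv))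

theorem IsHenkin.subst1 (h : φ.IsHenkin) (x : ℕ) (a : V) : (φ.subst1 x (Sum.inr a)).IsHenkin :=
  h.subst (isWitnessing_update_id x a)

theorem IsClosed.subst1 {x : ℕ} (h : (all x φ).IsClosed) (a : V) :
    (φ.subst1 x (Sum.inr a)).IsClosed := by
  intro y hy
  obtain ⟨v, hv, hvy⟩ := Finset.mem_image.1 (fv_subst_subset _ _ hy)
  by_cases hvx : v = Sum.inl x
  · simp [hvx] at hvy
  · rw [Function.update_of_ne hvx] at hvy
    obtain rfl : v = Sum.inl y := hvy
    exact h y (Finset.mem_erase.2 ⟨hvx, hv⟩)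

/-- Nothing is captured in between: `σ` leaves a variable alone or turns it into a witness, which no
quantifier binds and which `τ` fixes. -/
theorem subst_subst {σ τ : Var V → Var V} (hσ : IsWitnessing σ) (hτ : IsWitnessing τ)
    (φ : Fml V) : (φ.subst σ).subst τ = φ.subst (τ ∘ σ) := by
  induction φ generalizing σ τ with
  | rel n k args => rfl
  | bot => rfl
  | imp φ ψ ih1 ih2 => simp only [subst, ih1 hσ hτ, ih2 hσ hτ]
  | all x φ ih =>
    simp only [subst, ih (hσ.update x) (hτ.update x)]
    congr 2
    funext v
    by_cases hv : v = Sum.inl x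
    · simp [hv]
    · rw [Function.update_of_ne hv, Function.comp_apply, Function.update_of_ne hv,
        Function.update_of_ne]
      · rfl
      · rcases hσ v with h | ⟨_, d, -, h⟩
        · rwa [h]
        · rw [h]; exact Sum.inr_ne_inl
  | jst t X φ ih =>
    simp only [subst, ih (hσ.ite X) (hτ.ite _), Finset.image_image]
    congr 2
    funext v
    by_cases hv : v ∈ X
    · simp [hv, Finset.mem_image_of_mem σ hv]
    -- A variable outside `X` can enter the image of `X` only as a witness, so the second guard may
    -- differ but `τ` fixes it anyway.
    · simp only [Function.comp_apply, if_neg hv, ite_eq_right_iff]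
      intro h
      obtain ⟨u, hu, rfl⟩ := Finset.mem_image.1 h
      rcases hσ u with h | ⟨_, d, -, h⟩
      · exact absurd (h.symm ▸ hu) hv
      · rw [h, hτ.inr]

theorem isHenkin_alls {ys : List ℕ} : (alls ys φ).IsHenkin ↔ φ.IsHenkin := by
  induction ys with
  | nil => exact Iff.rfl
  | cons y ys ih => exact ih

theorem alls_subst1 {ys : List ℕ} {x : ℕ} (h : x ∉ ys) (a : Var V) :
    (alls ys φ).subst1 x a = alls ys (φ.subst1 x a) := by
  induction ys with
  | nil => rfl
  | cons y ys ih =>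
    rw [List.mem_cons, not_or] at h
    change Fml.all y ((alls ys φ).subst _) = Fml.all y (alls ys (φ.subst1 x a))
    rw [← ih h.2, Function.update_eq_self_iff.2]
    · rfl
    · rw [Function.update_of_ne (by simpa using Ne.symm h.1)]; rfl

end Witnesses

end Fml

/-! ### Countability of the syntax, for the enumeration in the extension lemma. -/

section Countable

/-- A numerical code of a term. -/
def Term.code : Term → ℕ
  | var i => Nat.pair 0 i
  | const i => Nat.pair 1 i
  | app t s => Nat.pair 2 (Nat.pair t.code s.code)
  | sum t s => Nat.pair 3 (Nat.pair t.code s.code)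
  | bang t => Nat.pair 4 t.code
  | quest t => Nat.pair 5 t.code
  | gen x t => Nat.pair 6 (Nat.pair x t.code)

theorem Term.code_injective : Function.Injective Term.code := by
  intro t
  induction t with
  | app t s ih1 ih2 =>
    rintro (_ | _ | _ | _ | _ | _ | _) h <;> simp only [code, Nat.pair_eq_pair] at h <;> try omega
    rw [ih1 h.2.1, ih2 h.2.2]
  | sum t s ih1 ih2 =>
    rintro (_ | _ | _ | _ | _ | _ | _) h <;> simp only [code, Nat.pair_eq_pair] at h <;> try omega
    rw [ih1 h.2.1, ih2 h.2.2]
  | gen x t ih =>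
    rintro (_ | _ | _ | _ | _ | _ | _) h <;> simp only [code, Nat.pair_eq_pair] at h <;> try omega
    rw [h.2.1, ih h.2.2]
  | bang t ih | quest t ih =>
    rintro (_ | _ | _ | _ | _ | _ | _) h <;> simp only [code, Nat.pair_eq_pair] at h <;> try omega
    rw [ih h.2]
  | var i | const i =>
    rintro (_ | _ | _ | _ | _ | _ | _) h <;> simp only [code, Nat.pair_eq_pair] at h <;> try omega
    rw [h.2]

/-- A numerical code of a template. -/
def Template.code : Template → ℕ
  | letter i => Nat.pair 0 i
  | neg F => Nat.pair 1 F.code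
  | or F G => Nat.pair 2 (Nat.pair F.code G.code)
  | and F G => Nat.pair 3 (Nat.pair F.code G.code)
  | box F => Nat.pair 4 F.code

theorem Template.code_injective : Function.Injective Template.code := by
  intro F
  induction F with
  | letter i =>
    rintro (_ | _ | _ | _ | _) h <;> simp only [code, Nat.pair_eq_pair] at h <;> try omega
    rw [h.2]
  | neg F ih | box F ih =>
    rintro (_ | _ | _ | _ | _) h <;> simp only [code, Nat.pair_eq_pair] at h <;> try omega
    rw [ih h.2]
  | or F G ih1 ih2 | and F G ih1 ih2 =>
    rintro (_ | _ | _ | _ | _) h <;> simp only [code, Nat.pair_eq_pair] at h <;> try omega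
    rw [ih1 h.2.1, ih2 h.2.2]

instance : Countable Template := Template.code_injective.countable

variable {V : Type u}

/-- A numerical code of a formula, given codes of atoms and of subscript sets. -/
def Fml.code (r : (Σ n, Fin n → Var V) → ℕ) (s : Finset (Var V) → ℕ) : Fml V → ℕ
  | rel n k args => Nat.pair 0 (Nat.pair k (r ⟨n, args⟩))
  | bot => Nat.pair 1 0
  | imp φ ψ => Nat.pair 2 (Nat.pair (φ.code r s) (ψ.code r s))
  | all x φ => Nat.pair 3 (Nat.pair x (φ.code r s))
  | jst t X φ => Nat.pair 4 (Nat.pair t.code (Nat.pair (s X) (φ.code r s)))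

theorem Fml.code_injective {r : (Σ n, Fin n → Var V) → ℕ} {s : Finset (Var V) → ℕ}
    (hr : Function.Injective r) (hs : Function.Injective s) :
    Function.Injective (Fml.code r s) := by
  intro φ
  induction φ with
  | rel n k args =>
    rintro (⟨m, l, args'⟩ | _ | _ | _ | _) h <;> simp only [code, Nat.pair_eq_pair] at h <;>
      try omega
    obtain ⟨-, rfl, h⟩ := h
    cases hr h
    rfl
  | bot =>
    rintro (_ | _ | _ | _ | _) h <;> simp only [code, Nat.pair_eq_pair] at h <;>
      first | omega | rfl
  | imp φ ψ ih1 ih2 =>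
    rintro (_ | _ | _ | _ | _) h <;> simp only [code, Nat.pair_eq_pair] at h <;> try omega
    rw [ih1 h.2.1, ih2 h.2.2]
  | all x φ ih =>
    rintro (_ | _ | _ | _ | _) h <;> simp only [code, Nat.pair_eq_pair] at h <;> try omega
    rw [h.2.1, ih h.2.2]
  | jst t X φ ih =>
    rintro (_ | _ | _ | _ | _) h <;> simp only [code, Nat.pair_eq_pair] at h <;> try omega
    rw [Term.code_injective h.2.1, hs h.2.2.1, ih h.2.2.2]

instance [Countable V] : Countable (Fml V) :=
  have ⟨_, hr⟩ := exists_injective_nat (Σ n, Fin n → Var V)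
  have ⟨_, hs⟩ := exists_injective_nat (Finset (Var V))
  (Fml.code_injective hr hs).countable

end Countable

/-! ### Maximal consistent sets, `Γ^#`, and preservation of instantiation. -/

section Worlds

variable {V : Type u} [DecidableEq V] {CS : Set (Fml Empty)} {Γ Δ : Set (Fml V)}
  {φ ψ : Fml V}

theorem Der.subst1 {x : ℕ} (h : Der CS Γ (all x φ)) (a : V) :
    Der CS Γ (φ.subst1 x (Sum.inr a)) :=
  .mp h (.ax ⟨h.henkin, IsHenkin.subst1 (φ := φ) h.henkin x a⟩
    (.inst _ _ _ (IsHenkin.freeFor (φ := φ) h.henkin a x)))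

theorem Der.of_alls {ys : List ℕ} (h : Der CS Γ (alls ys φ)) : Der CS Γ φ := by
  induction ys with
  | nil => exact h
  | cons y ys ih =>
    refine ih (.mp h (.ax ⟨h.henkin, h.henkin⟩ ?_))
    have := IsAx.inst y _ (alls ys φ) (.self y _)
    rwa [subst1_self] at this

theorem Der.subst_of_alls {ys : List ℕ} (hys : ys.Nodup) (h : Der CS Γ (alls ys φ)) (a : ℕ → V) :
    Der CS Γ (φ.subst
      (Sum.elim (fun x => if x ∈ ys then Sum.inr (a x) else Sum.inl x) Sum.inr)) := by
  induction ys generalizing φ with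
  | nil =>
    have : (Sum.elim (fun x => if x ∈ ([] : List ℕ) then Sum.inr (a x) else Sum.inl x) Sum.inr)
        = (id : Var V → Var V) := by
      funext v; rcases v with x | d <;> simp
    rwa [this, subst_id]
  | cons y ys ih =>
    rw [List.nodup_cons] at hys
    have h1 := Der.subst1 (φ := alls ys φ) h (a y)
    rw [alls_subst1 hys.1] at h1
    have h2 := ih hys.2 h1
    rw [Fml.subst1, subst_subst (isWitnessing_update_id _ _)] at h2
    · convert h2 using 2
      funext v
      rcases v with x | d
      · by_cases hx : x = y
        · simp [hx]
        · simp [hx]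
      · simp
    · rintro (x | d)
      · by_cases hx : x ∈ ys
        · exact .inr ⟨x, a x, rfl, by simp [hx]⟩
        · left; simp [hx]
      · exact .inl rfl

namespace MaxConsistent

variable [Countable V] (happ : AxiomaticallyAppropriate CS)
  (hΓ : MaxConsistent (extend CS) Γ)

include happ hΓ

theorem not_der_bot : ¬ Der CS Γ bot :=
  (consistent_iff happ hΓ.henkin).1 hΓ.consistent

theorem subset_of_consistent (hΔ : ∀ ψ ∈ Δ, ψ.IsHenkin) (h : ¬ Der CS (Γ ∪ Δ) bot) : Δ ⊆ Γ := by
  have hH : ∀ ψ ∈ Γ ∪ Δ, ψ.IsHenkin := fun ψ hψ => hψ.elim (hΓ.henkin ψ) (hΔ ψ)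
  rw [← hΓ.maximal _ hH ((consistent_iff happ hH).2 h) Set.subset_union_left]
  exact Set.subset_union_right

theorem mem_iff_der : φ ∈ Γ ↔ Der CS Γ φ := by
  refine ⟨fun h => .hyp (hΓ.henkin _ h) h, fun h => ?_⟩
  refine Set.singleton_subset_iff.1 (hΓ.subset_of_consistent happ (Δ := {φ}) ?_ ?_)
  · rintro ψ rfl; exact h.henkin
  · intro hb
    refine hΓ.not_der_bot happ (hb.cut ?_)
    rintro ψ (hψ | rfl) hH
    · exact .hyp hH hψ
    · exact h

theorem neg_mem_of_notMem (hφ : φ.IsHenkin) (h : φ ∉ Γ) : neg φ ∈ Γ := by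
  have hn : (neg φ).IsHenkin := ⟨hφ, trivial⟩
  refine Set.singleton_subset_iff.1 (hΓ.subset_of_consistent happ (Δ := {neg φ}) ?_ ?_)
  · rintro ψ rfl; exact hn
  · intro hb
    rw [Set.union_singleton] at hb
    exact h ((hΓ.mem_iff_der happ).2 (.by_contra hφ hb))

theorem notMem_of_neg_mem (h : neg φ ∈ Γ) : φ ∉ Γ := fun h' =>
  hΓ.not_der_bot happ (.mp ((hΓ.mem_iff_der happ).1 h') ((hΓ.mem_iff_der happ).1 h))

end MaxConsistent

theorem henkin_sharp : ∀ ψ ∈ sharp Γ, ψ.IsHenkin := by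
  rintro ψ ⟨t, φ, ys, -, h, -, -, -, rfl⟩
  exact isHenkin_alls.2 h.2

theorem exists_sharp (h : φ.IsHenkin) {t : Term} (ht : jst t φ.witSet φ ∈ Γ) :
    ∃ ys : List ℕ, ys.Nodup ∧ (∀ y, y ∈ ys ↔ Sum.inl y ∈ φ.fv) ∧ alls ys φ ∈ sharp Γ := by
  have hys : ∀ y, y ∈ φ.fv.toLeft.toList ↔ Sum.inl y ∈ φ.fv := by simp
  exact ⟨_, Finset.nodup_toList _, hys, t, φ, _, ht, IsHenkin.jst_witSet h t,
    fun x => inl_notMem_witSet x φ, Finset.nodup_toList _, hys, rfl⟩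

/-- Each premise in `Γ^#` is a universal closure of a formula justified in `Γ`; iterating `gen`
justifies the closure, and internalization does the rest. -/
theorem justified_of_der_sharp [Countable V] (happ : AxiomaticallyAppropriate CS)
    (h : Der CS (sharp Γ) φ) : Justified CS Γ φ := by
  refine .of_der happ h ?_
  rintro ψ ⟨t, φ, ys, ht, hH, -, -, -, rfl⟩ -
  exact Justified.alls ⟨t, .hyp hH ht⟩ ys

/-- `AdmitsInstantiation`, for derivability by modus ponens. -/
def Instantiable (CS : Set (Fml Empty)) (Γ : Set (Fml V)) : Prop :=
  ∀ (F : Template) (q : ℕ) (e : ℕ → Fml V) (x : ℕ) (φ : Fml V),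
    F.IsDisjunctive → (∀ i, (e i).IsHenkin) → φ.IsHenkin →
    ¬ Der CS (Γ ∪ (Template.neg F).inst (Function.update e q (all x φ))) bot →
    ∃ a : V, ¬ Der CS
      (Γ ∪ (Template.neg F).inst (Function.update e q (φ.subst1 x (Sum.inr a)))) bot

theorem henkin_update {e : ℕ → Fml V} (he : ∀ i, (e i).IsHenkin) (hφ : φ.IsHenkin) (q : ℕ) :
    ∀ i, (Function.update e q φ i).IsHenkin := fun i => by
  by_cases h : i = q
  · subst h; simpa using hφ
  · rw [Function.update_of_ne h]; exact he i

theorem henkin_union_inst (hΓ : ∀ ψ ∈ Γ, ψ.IsHenkin) {e : ℕ → Fml V} (he : ∀ i, (e i).IsHenkin)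
    (F : Template) : ∀ ψ ∈ Γ ∪ F.inst e, ψ.IsHenkin := fun ψ hψ =>
  hψ.elim (hΓ ψ) (Template.isHenkin_of_mem_inst he)

theorem admitsInstantiation_iff [Countable V] (happ : AxiomaticallyAppropriate CS)
    (hΓ : ∀ ψ ∈ Γ, ψ.IsHenkin) :
    AdmitsInstantiation (extend CS) Γ ↔ Instantiable CS Γ := by
  unfold AdmitsInstantiation Instantiable
  refine forall₅_congr fun F q e x φ => forall₃_congr fun _ he hφ => ?_
  have hφ' : (all x φ).IsHenkin := hφ
  rw [consistent_iff happ (henkin_union_inst hΓ (henkin_update he hφ' q) _)]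
  refine imp_congr_right fun _ => exists_congr fun a => ?_
  rw [consistent_iff happ (henkin_union_inst hΓ (henkin_update he (hφ.subst1 x a) q) _)]

/-- If `⟦¬F(∀ x φ)⟧` is consistent with `Γ^#`, then `Γ` contains all of `⟦¬□F(∀ x φ)⟧`, since `t :_X
ψ ∈ Γ` would put a universal closure of `ψ` into `Γ^#`. Instantiation in `Γ` and maximality give
`⟦¬□F(φ(a))⟧ ⊆ Γ`. Were `⟦¬F(φ(a))⟧` inconsistent with `Γ^#`, some `ψ ∈ ⟦F(φ(a))⟧` would follow from
`Γ^#` and hence be justified in `Γ`. -/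
theorem instantiable_sharp [Countable V] (happ : AxiomaticallyAppropriate CS)
    (hΓ : MaxConsistent (extend CS) Γ) (hI : Instantiable CS Γ) : Instantiable CS (sharp Γ) := by
  intro F q e x φ hF he hφ hcon
  have he1 := henkin_update (φ := all x φ) he hφ q
  have hmem : (Template.neg (.box F)).inst (Function.update e q (all x φ)) ⊆ Γ := by
    rintro _ ⟨_, ⟨ψ, hψ, t, rfl⟩, rfl⟩
    have hψH := Template.isHenkin_of_mem_inst he1 hψ
    refine hΓ.neg_mem_of_notMem happ (IsHenkin.jst_witSet hψH t) fun ht => hcon ?_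
    obtain ⟨ys, -, -, h⟩ := exists_sharp hψH ht
    exact .mp (Der.of_alls (.hyp (isHenkin_alls.2 hψH) (.inl h)))
      (.hyp ⟨hψH, trivial⟩ (.inr ⟨ψ, hψ, rfl⟩))
  obtain ⟨a, ha⟩ := hI (.box F) q e x φ hF he hφ (by
    rw [Set.union_eq_left.2 hmem]; exact hΓ.not_der_bot happ)
  have he2 := henkin_update he (hφ.subst1 x a) q
  have hsub := hΓ.subset_of_consistent happ (fun ψ => Template.isHenkin_of_mem_inst he2) ha
  refine ⟨a, fun hb => ?_⟩
  obtain ⟨ψ, hψ, hd⟩ := Template.exists_der_of_der_bot happ he2 hF.2 hb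
  obtain ⟨t, ht⟩ := justified_of_der_sharp happ hd
  exact hΓ.notMem_of_neg_mem happ (hsub ⟨_, ⟨ψ, hψ, t, rfl⟩, rfl⟩) ((hΓ.mem_iff_der happ).2 ht)

/-- This is De Morgan's law; extracting one negated disjunct uses that the instantiation set of the
other is nonempty. -/
theorem der_neg_or_inst_iff {F G : Template} {e : ℕ → Fml V} (he : ∀ i, (e i).IsHenkin) :
    Der CS (Γ ∪ (Template.neg (.or F G)).inst e) φ ↔
      Der CS (Γ ∪ (Template.neg F).inst e ∪ (Template.neg G).inst e) φ := by
  constructor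
  · refine fun h => h.cut ?_
    rintro _ (hψ | ⟨_, ⟨ψ, hψ, θ, hθ, rfl⟩, rfl⟩) hH
    · exact .hyp hH (.inl (.inl hψ))
    · exact .not_or (.hyp ⟨hH.1.1.1, trivial⟩ (.inl (.inr ⟨_, hψ, rfl⟩)))
        (.hyp ⟨hH.1.2, trivial⟩ (.inr ⟨_, hθ, rfl⟩))
  · refine fun h => h.cut ?_
    rintro _ ((hψ | ⟨ψ, hψ, rfl⟩) | ⟨θ, hθ, rfl⟩) hH
    · exact .hyp hH (.inl hψ)
    · obtain ⟨θ, hθ⟩ := G.inst_nonempty e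
      have hθH := Template.isHenkin_of_mem_inst he hθ
      refine .imp_intro hH.1 (.mp (.or_inl (.hyp_insert hH.1) hθH) (Der.insert (.hyp ?_ ?_)))
      · exact ⟨⟨⟨hH.1, trivial⟩, hθH⟩, trivial⟩
      · exact .inr ⟨_, ⟨ψ, hψ, θ, hθ, rfl⟩, rfl⟩
    · obtain ⟨ψ, hψ⟩ := F.inst_nonempty e
      have hψH := Template.isHenkin_of_mem_inst he hψ
      refine .imp_intro hH.1 (.mp (.or_inr (.hyp_insert hH.1) hψH) (Der.insert (.hyp ?_ ?_)))
      · exact ⟨⟨⟨hψH, trivial⟩, hH.1⟩, trivial⟩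
      · exact .inr ⟨_, ⟨ψ, hψ, θ, hθ, rfl⟩, rfl⟩

/-- Adding `⟦¬F⟧` and then testing `G` amounts to testing the single template `F ∨ G` over `Γ`. -/
theorem Instantiable.union_inst (hI : Instantiable CS Γ) {F : Template} {e : ℕ → Fml V}
    (hF : F.IsDisjunctive) (he : ∀ i, (e i).IsHenkin) :
    Instantiable CS (Γ ∪ (Template.neg F).inst e) := by
  intro G q e' x φ hG he' hφ hcon
  -- the letters of `F` are moved past those of `G`
  obtain ⟨k, hqk, hk⟩ : ∃ k, q < k ∧ ∀ i ∈ G.letters, i < k := by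
    refine ⟨(insert q G.letters.toFinset).sup id + 1, Nat.lt_succ_of_le ?_,
      fun i hi => Nat.lt_succ_of_le ?_⟩
    · exact Finset.le_sup (f := id) (Finset.mem_insert_self _ _)
    · exact Finset.le_sup (f := id) (Finset.mem_insert_of_mem (List.mem_toFinset.2 hi))
  -- Letters below `k` serve `G` and those from `k` on serve the shifted `F`; since `q < k`,
  -- updating at `q` does not affect `F`.
  let d : ℕ → Fml V := fun i => if i < k then e' i else e (i - k)
  have hd : ∀ i, (d i).IsHenkin := fun i => by
    by_cases h : i < k
    · simpa [d, h] using he' i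
    · simpa [d, h] using he (i - k)
  have hdisj : (Template.or (F.shift k) G).IsDisjunctive := by
    refine ⟨?_, Template.onlyOr_shift hF.2, hG.2⟩
    refine List.Nodup.append (hF.shift k).1 hG.1 fun i hi hi' => ?_
    rw [Template.letters_shift, List.mem_map] at hi
    obtain ⟨j, -, rfl⟩ := hi
    exact absurd (hk _ hi') (by omega)
  have hinstF : ∀ χ, (Template.neg (F.shift k)).inst (Function.update d q χ)
      = (Template.neg F).inst e := fun χ => by
    change ((Template.neg F).shift k).inst _ = _
    rw [Template.inst_shift]
    refine Template.inst_congr fun i _ => ?_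
    rw [Function.update_of_ne (by omega)]
    simp [d]
  have hinstG : ∀ χ, (Template.neg G).inst (Function.update d q χ)
      = (Template.neg G).inst (Function.update e' q χ) := fun χ => by
    refine Template.inst_congr fun i hi => ?_
    by_cases hiq : i = q
    · simp [hiq]
    · rw [Function.update_of_ne hiq, Function.update_of_ne hiq]
      simp [d, hk i hi]
  obtain ⟨a, ha⟩ := hI _ q d x φ hdisj hd hφ (by
    rwa [der_neg_or_inst_iff (henkin_update (φ := all x φ) hd hφ q), hinstF, hinstG])
  rw [der_neg_or_inst_iff (henkin_update hd (hφ.subst1 x a) q), hinstF, hinstG] at ha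
  exact ⟨a, ha⟩

end Worlds

/-! ### The extension lemma and the truth lemma. -/

section Worlds

variable {V : Type u} [DecidableEq V] {CS : Set (Fml Empty)} {Γ Δ : Set (Fml V)}
  {φ ψ : Fml V}

theorem Der.of_iUnion {s : ℕ → Set (Fml V)} (hs : Monotone s) (h : Der CS (⋃ n, s n) φ) :
    ∃ n, Der CS (s n) φ := by
  induction h with
  | ax hφ h => exact ⟨0, .ax hφ h⟩
  | spec h => exact ⟨0, .spec h⟩
  | hyp hφ h =>
    obtain ⟨n, hn⟩ := Set.mem_iUnion.1 h
    exact ⟨n, .hyp hφ hn⟩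
  | mp _ _ ih1 ih2 =>
    obtain ⟨m, hm⟩ := ih1
    obtain ⟨n, hn⟩ := ih2
    exact ⟨max m n, .mp (hm.mono (hs (le_max_left m n))) (hn.mono (hs (le_max_right m n)))⟩

/-- Assignments of formulas to all letters are uncountably many; a template reads only finitely many
letters, so finite lists suffice and the instantiation tasks can be enumerated. -/
theorem inst_getD {F : Template} {e : ℕ → Fml V} {L : List (Fml V)}
    (hL : ∀ i ∈ F.letters, L.getD i bot = e i) (q : ℕ) (χ : Fml V) :
    (Template.neg F).inst (Function.update (fun i => L.getD i bot) q χ)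
      = (Template.neg F).inst (Function.update e q χ) := by
  refine Template.inst_congr fun i hi => ?_
  by_cases hiq : i = q
  · simp [hiq]
  · rw [Function.update_of_ne hiq, Function.update_of_ne hiq]
    exact hL i hi

/-- The increasing sequence of sets in the proof of the extension lemma: every set of formulas
`¬ F(φ⃗, ∀ x φ)` that remains consistent is followed by some `¬ F(φ⃗, φ(a))`. -/
theorem exists_witnessed_extension [Countable V] (hΓ : ∀ ψ ∈ Γ, ψ.IsHenkin)
    (hcon : ¬ Der CS Γ bot) (hI : Instantiable CS Γ) :
    ∃ Δ : Set (Fml V), Γ ⊆ Δ ∧ (∀ ψ ∈ Δ, ψ.IsHenkin) ∧ ¬ Der CS Δ bot ∧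
      ∀ (F : Template) (q : ℕ) (e : ℕ → Fml V) (x : ℕ) (φ : Fml V),
        F.IsDisjunctive → (∀ i, (e i).IsHenkin) → φ.IsHenkin →
        ¬ Der CS (Δ ∪ (Template.neg F).inst (Function.update e q (all x φ))) bot →
        ∃ a : V, (Template.neg F).inst (Function.update e q (φ.subst1 x (Sum.inr a))) ⊆ Δ := by
  let St := {Γ : Set (Fml V) // (∀ ψ ∈ Γ, ψ.IsHenkin) ∧ ¬ Der CS Γ bot ∧ Instantiable CS Γ}
  let Data := Template × ℕ × List (Fml V) × ℕ × Fml V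
  let env : List (Fml V) → ℕ → Fml V := fun L i => L.getD i bot
  have step : ∀ (d : Data) (s : St), ∃ s' : St, s.1 ⊆ s'.1 ∧
      (d.1.IsDisjunctive → (∀ i, (env d.2.2.1 i).IsHenkin) → d.2.2.2.2.IsHenkin →
        ¬ Der CS (s.1 ∪ (Template.neg d.1).inst
          (Function.update (env d.2.2.1) d.2.1 (all d.2.2.2.1 d.2.2.2.2))) bot →
        ∃ a : V, (Template.neg d.1).inst (Function.update (env d.2.2.1) d.2.1
          (d.2.2.2.2.subst1 d.2.2.2.1 (Sum.inr a))) ⊆ s'.1) := by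
    rintro ⟨F, q, L, x, φ⟩ s
    by_cases h : F.IsDisjunctive ∧ (∀ i, (env L i).IsHenkin) ∧ φ.IsHenkin ∧
        ¬ Der CS (s.1 ∪ (Template.neg F).inst (Function.update (env L) q (all x φ))) bot
    · obtain ⟨hF, he, hφ, hc⟩ := h
      obtain ⟨a, ha⟩ := s.2.2.2 F q _ x φ hF he hφ hc
      have he' := henkin_update he (hφ.subst1 x a) q
      exact ⟨⟨_, henkin_union_inst s.2.1 he' _, ha, s.2.2.2.union_inst hF he'⟩,
        Set.subset_union_left, fun _ _ _ _ => ⟨a, Set.subset_union_right⟩⟩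
    · exact ⟨s, subset_rfl, fun h1 h2 h3 h4 => absurd ⟨h1, h2, h3, h4⟩ h⟩
  choose next hsub hnext using step
  have : Nonempty Data := ⟨(.letter 0, 0, [], 0, bot)⟩
  obtain ⟨d, hd⟩ := exists_surjective_nat Data
  let s : ℕ → St := fun n => Nat.rec ⟨Γ, hΓ, hcon, hI⟩ (fun n s => next (d n) s) n
  have hmono : Monotone fun n => (s n).1 := monotone_nat_of_le_succ fun n => hsub (d n) (s n)
  refine ⟨⋃ n, (s n).1, Set.subset_iUnion (fun n => (s n).1) 0, ?_, ?_, ?_⟩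
  · intro ψ hψ
    obtain ⟨n, hn⟩ := Set.mem_iUnion.1 hψ
    exact (s n).2.1 ψ hn
  · intro h
    obtain ⟨n, hn⟩ := h.of_iUnion hmono
    exact (s n).2.2.1 hn
  · intro F q e x φ hF he hφ hc
    let L := (List.range (F.letters.toFinset.sup id + 1)).map e
    have hL : ∀ i ∈ F.letters, L.getD i bot = e i := fun i hi => by
      have : i < F.letters.toFinset.sup id + 1 :=
        Nat.lt_succ_of_le (Finset.le_sup (f := id) (List.mem_toFinset.2 hi))
      simp [L, this]
    have hLH : ∀ i, (env L i).IsHenkin := fun i => by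
      by_cases hi : i < F.letters.toFinset.sup id + 1
      · simpa [env, L, hi] using he i
      · simp [env, L, hi, IsHenkin]
    obtain ⟨n, hn⟩ := hd (F, q, L, x, φ)
    have := hnext (d n) (s n)
    rw [hn] at this
    have hle : (s n).1 ∪ (Template.neg F).inst (Function.update (env L) q (all x φ)) ⊆
        (⋃ n, (s n).1) ∪ (Template.neg F).inst (Function.update e q (all x φ)) := by
      rw [inst_getD hL]
      exact Set.union_subset_union_left _ (Set.subset_iUnion (fun n => (s n).1) n)
    -- One visit to each task is enough: consistency with the limit implies consistency with the
    -- smaller stage `n`, where the task was handled.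
    obtain ⟨a, ha⟩ := this hF hLH hφ fun h => hc (h.mono hle)
    refine ⟨a, fun ψ hψ => Set.mem_iUnion.2 ⟨n + 1, ?_⟩⟩
    change ψ ∈ (next (d n) (s n)).1
    rw [hn]
    refine ha ?_
    rwa [inst_getD hL]

/-- A consistent set that admits instantiation is included in a world of the canonical model. -/
theorem exists_world [Countable V] (happ : AxiomaticallyAppropriate CS)
    (hΓ : ∀ ψ ∈ Γ, ψ.IsHenkin) (hcon : ¬ Der CS Γ bot) (hI : Instantiable CS Γ) :
    ∃ Δ : Set (Fml V), Γ ⊆ Δ ∧ MaxConsistent (extend CS) Δ ∧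
      AdmitsInstantiation (extend CS) Δ := by
  obtain ⟨Δ, hsub, hΔ, hΔcon, hwit⟩ := exists_witnessed_extension hΓ hcon hI
  -- Witnessing also decides every formula: in the one-letter template for `ψ` the letter `1` to be
  -- instantiated does not occur, so the quantified formula is a dummy and a consistent `¬ψ` has
  -- been added outright.
  have hcomplete : ∀ ψ : Fml V, ψ.IsHenkin → Der CS Δ ψ ∨ Der CS Δ (neg ψ) := by
    intro ψ hψ
    by_cases h : Der CS Δ ψ
    · exact .inl h
    · right
      have hinst : ∀ χ : Fml V, (Template.neg (.letter 0)).inst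
          (Function.update (fun _ => ψ) 1 χ) = {neg ψ} := fun χ => by
        ext; simp [Template.inst]
      obtain ⟨a, ha⟩ := hwit (.letter 0) 1 (fun _ => ψ) 0 bot
        ⟨List.nodup_singleton _, trivial⟩ (fun _ => hψ) trivial fun hb => h (by
          rw [hinst, Set.union_singleton] at hb
          exact .by_contra hψ hb)
      rw [hinst, Set.singleton_subset_iff] at ha
      exact .hyp ⟨hψ, trivial⟩ ha
  have hH : ∀ ψ ∈ {ψ | Der CS Δ ψ}, ψ.IsHenkin := fun ψ h => h.henkin
  refine ⟨{ψ | Der CS Δ ψ}, fun ψ hψ => .hyp (hΓ ψ hψ) (hsub hψ), ⟨hH, ?_, ?_⟩, ?_⟩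
  · rw [consistent_iff happ hH]
    exact fun h => hΔcon (h.cut fun _ h _ => h)
  · intro Θ hΘ hΘcon hle
    rw [consistent_iff happ hΘ] at hΘcon
    refine Set.Subset.antisymm (fun ψ hψ => ?_) hle
    refine (hcomplete ψ (hΘ ψ hψ)).resolve_right fun h => hΘcon ?_
    exact .mp (.hyp (hΘ ψ hψ) hψ) (.hyp h.henkin (hle h))
  · rw [admitsInstantiation_iff happ hH]
    intro F q e x φ hF he hφ hc
    obtain ⟨a, ha⟩ := hwit F q e x φ hF he hφ fun h => hc (h.mono
      (Set.union_subset_union_left _ fun ψ hψ => .hyp (hΔ ψ hψ) hψ))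
    refine ⟨a, fun h => hΔcon (h.cut ?_)⟩
    rintro ψ (h | h) hψ
    · exact h
    · exact .hyp hψ (ha h)

/-- If no justification of `φ` belongs to a world, then `φ` is missing from some accessible
world. -/
theorem exists_accessible_notMem [Countable V] (happ : AxiomaticallyAppropriate CS)
    (hΓ : MaxConsistent (extend CS) Γ) (hI : AdmitsInstantiation (extend CS) Γ)
    (hφ : φ.IsHenkin) (h : ∀ t, jst t φ.witSet φ ∉ Γ) :
    ∃ Δ : Set (Fml V), sharp Γ ⊆ Δ ∧ φ ∉ Δ ∧ MaxConsistent (extend CS) Δ ∧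
      AdmitsInstantiation (extend CS) Δ := by
  have hS := instantiable_sharp happ hΓ ((admitsInstantiation_iff happ hΓ.henkin).1 hI)
  -- The single formula `¬φ` is itself an instantiation set, so `union_inst` lets it be added to
  -- `Γ^#`.
  have hinst : (Template.neg (.letter 0)).inst (fun _ => φ) = {neg φ} := by
    ext; simp [Template.inst]
  obtain ⟨Δ, hsub, hmax, hadm⟩ := exists_world happ
    (henkin_union_inst henkin_sharp (fun _ => hφ) (.neg (.letter 0))) (fun hb => by
      rw [hinst, Set.union_singleton] at hb
      obtain ⟨t, ht⟩ := justified_of_der_sharp happ (Der.by_contra hφ hb)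
      exact h t ((hΓ.mem_iff_der happ).2 ht))
    (hS.union_inst ⟨List.nodup_singleton _, trivial⟩ fun _ => hφ)
  rw [hinst] at hsub
  exact ⟨Δ, Set.subset_union_left.trans hsub,
    hmax.notMem_of_neg_mem happ (hsub (.inr rfl)), hmax, hadm⟩

/-- The truth lemma. -/
theorem truth_iff_mem [Countable V] (happ : AxiomaticallyAppropriate CS) (n : ℕ) :
    ∀ φ : Fml V, φ.degree ≤ n → φ.IsHenkin → φ.IsClosed → ∀ w : (canonicalModel V CS).W,
      (canonicalModel V CS).Truth w φ ↔ φ ∈ w.1 := by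
  -- The induction is on degree because the instances `ψ(a)` are not subformulas of `∀ x ψ`;
  -- substitution preserves degree.
  induction n using Nat.strong_induction_on with
  | _ n ih =>
  have ih : ∀ φ : Fml V, φ.degree < n → φ.IsHenkin → φ.IsClosed →
      ∀ w : (canonicalModel V CS).W, (canonicalModel V CS).Truth w φ ↔ φ ∈ w.1 :=
    fun φ hφ => ih _ hφ φ le_rfl
  intro φ hn hφ hcl w
  have hw := w.2.1
  have hder : ∀ {φ}, φ ∈ w.1 ↔ Der CS w.1 φ := hw.mem_iff_der happ
  cases φ with
  | rel m k args =>
    rw [Model.Truth]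
    constructor
    · rintro ⟨a, ha, hmem⟩
      obtain rfl : args = fun i => Sum.inr (a i) := funext ha
      exact hmem
    · intro h
      have : ∀ i, ∃ a, args i = Sum.inr a := fun i => by
        rcases hi : args i with x | a
        · exact absurd (by simp [fv, ← hi]) (hcl x)
        · exact ⟨a, rfl⟩
      choose a ha using this
      obtain rfl : args = fun i => Sum.inr (a i) := funext ha
      exact ⟨a, fun _ => rfl, h⟩
  | bot =>
    rw [Model.Truth, false_iff]
    exact fun h => hw.not_der_bot happ (hder.1 h)
  | imp φ ψ =>
    simp only [degree] at hn
    have hc1 : φ.IsClosed := fun x hx => hcl x (Finset.mem_union_left _ hx)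
    have hc2 : ψ.IsClosed := fun x hx => hcl x (Finset.mem_union_right _ hx)
    rw [Model.Truth, ih φ (by omega) hφ.1 hc1, ih ψ (by omega) hφ.2 hc2]
    constructor
    · rintro (h | h)
      · have hneg := hder.1 (hw.neg_mem_of_notMem happ hφ.1 h)
        exact hder.2 (.imp_intro hφ.1
          (.exfalso (.mp (.hyp_insert hφ.1) hneg.insert) hφ.2))
      · exact hder.2 (.imp_intro_of hφ.1 (hder.1 h))
    · intro h
      by_cases h1 : φ ∈ w.1
      · exact .inr (hder.2 (.mp (hder.1 h1) (hder.1 h)))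
      · exact .inl h1
  | all x ψ =>
    simp only [degree] at hn
    have hψ : ψ.IsHenkin := hφ
    rw [Model.Truth]
    have hiff : ∀ a : V, (canonicalModel V CS).Truth w (ψ.subst1 x (Sum.inr a)) ↔
        ψ.subst1 x (Sum.inr a) ∈ w.1 := fun a =>
      ih _ (by rw [subst1, degree_subst]; omega) (hψ.subst1 x a) (IsClosed.subst1 hcl a) w
    simp only [hiff]
    refine ⟨fun h => ?_, fun h a => hder.2 ((hder.1 h).subst1 a)⟩
    by_contra hnot
    -- For the one-letter template, admitting instantiation is the Henkin property: since `¬∀ x ψ`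
    -- is in the world, some `¬ψ(a)` is consistent with it.
    have hinst : ∀ χ : Fml V, (Template.neg (.letter 0)).inst
        (Function.update (fun _ => bot) 0 χ) = {neg χ} := fun χ => by
      ext; simp [Template.inst]
    obtain ⟨a, ha⟩ := (admitsInstantiation_iff happ hw.henkin).1 w.2.2 (.letter 0) 0
      (fun _ => bot) x ψ ⟨List.nodup_singleton _, trivial⟩ (fun _ => trivial) hψ (by
        rw [hinst, Set.union_eq_left.2
          (Set.singleton_subset_iff.2 (hw.neg_mem_of_notMem happ hφ hnot))]
        exact hw.not_der_bot happ)
    rw [hinst, Set.union_singleton] at ha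
    have hH : (neg (ψ.subst1 x (Sum.inr a))).IsHenkin := ⟨hψ.subst1 x a, trivial⟩
    exact ha (.mp (Der.insert (hder.1 (h a))) (.hyp_insert hH))
  | jst t X ψ =>
    simp only [degree] at hn
    rw [Model.Truth]
    -- Evidence mentions only the least subscript; closedness of the formula allows any `X` to be
    -- exchanged for it.
    have hX : jst t X ψ ∈ w.1 ↔ jst t ψ.witSet ψ ∈ w.1 := by
      rw [hder, hder, Der.jst_witSet_iff hφ.1 hcl]
    rw [hX]
    -- Evidence alone gives membership. Conversely, the universal closure of `ψ` lies in `Γ^#`,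
    -- hence in each accessible world, where all instances of `ψ` follow.
    refine ⟨fun h => h.1.2.2, fun h => ⟨⟨IsHenkin.jst_witSet hφ.2 t,
      fun x => inl_notMem_witSet x ψ, h⟩, fun w' hww' a => ?_⟩⟩
    have hσ : IsWitnessing (Sum.elim (fun x => Sum.inr (a x)) Sum.inr : Var V → Var V) := by
      rintro (x | d)
      · exact .inr ⟨x, a x, rfl, rfl⟩
      · exact .inl rfl
    rw [ih _ (by rw [degree_subst]; omega) (hφ.2.subst hσ)]
    · obtain ⟨ys, hnodup, hys, hmem⟩ := exists_sharp hφ.2 h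
      have hd := (w'.2.1.mem_iff_der happ).1 (hww' hmem)
      rw [w'.2.1.mem_iff_der happ]
      convert hd.subst_of_alls hnodup a using 1
      refine subst_congr ?_
      rintro (x | d) hv
      · simp [(hys x).2 hv]
      · rfl
    · intro y hy
      obtain ⟨v, -, hv⟩ := Finset.mem_image.1 (fv_subst_subset _ _ hy)
      rcases v with x | d <;> simp at hv

end Worlds

end FOJT45

theorem mainTheorem8 (V : Type*) [DecidableEq V] [Countable V] [Infinite V]
    (CS : Set (FOJT45.Fml Empty))
    (hCS : FOJT45.IsConstantSpecification CS)
    (hvar : FOJT45.VariantClosed CS)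
    (happ : FOJT45.AxiomaticallyAppropriate CS) :
    (FOJT45.canonicalModel V CS).FullyExplanatory := by
  intro φ hφ hcl w h
  by_contra! hno
  obtain ⟨Δ, hR, hnot, hΔ, hΔI⟩ := FOJT45.exists_accessible_notMem happ w.2.1 w.2.2 hφ fun t ht =>
    hno t ((FOJT45.truth_iff_mem happ _ _ le_rfl (FOJT45.IsHenkin.jst_witSet hφ t)
      (fun x => FOJT45.inl_notMem_witSet x φ) w).2 ht)
  exact hnot ((FOJT45.truth_iff_mem happ _ φ le_rfl hφ hcl ⟨Δ, hΔ, hΔI⟩).1 (h ⟨Δ, hΔ, hΔI⟩ hR))
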